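/- Consider the $M/M_D/2$ queue with homogeneous servers: customers arrive according to a Poisson process of rate $\lambda>0$ to a system with two servers and an infinite waiting room, and the pair of service times of the two servers has the Marshall--Olkin bivariate exponential distribution with parameters $\mu_1=\mu_2=\mu\ge 0$ and $\mu_{12}\ge 0$, i.e. survival function $e^{-\mu x-\mu y-\mu_{12}\max(x,y)}$ for $x,y\ge 0$. The system is constructed from the shock model. There are independent clocks, independent of the arrivals: single shocks $T_1,T_2\sim\mathrm{Exp}(\mu)$ and a common shock $T_{12}\sim\mathrm{Exp}(\mu_{12})$ (a clock of rate $0$ never rings); a service at server $i$ ends at the first of $T_i$ and $T_{12}$. A service started when the system is empty, or two services started simultaneously, use fresh clocks; a service started at one server while the other one is already busy, or continues to be busy, uses a fresh single clock and the residual common clock. When both servers are busy, a common shock completes both services simultaneously. A single customer who has to be sent to one of two free servers goes to server $1$ with probability $p$ and to server $2$ with probability $1-p$, independently of everything else, where $0\le p\le 1$. The initial configuration (an empty system; one customer, at a specified server; or $n\ge 2$ customers) is arbitrary, possibly random, and independent of the clocks and of these choices, and all clocks running at time $0$ are fresh. Let $X(t)$ be the number of customers in the system at time $t\ge 0$. Then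 $\{X(t):t\ge 0\}$ is a continuous-time Markov chain on $S_0=\{0,1,2,\dots\}$ with transition rate matrix $Q_0=(q_{ij})$, where \[ \begin{aligned} &q_{01}=\lambda,\quad q_{00}=-\lambda;\\ &q_{10}=\mu+\mu_{12},\quad q_{12}=\lambda,\quad q_{11}=-(\lambda+\mu+\mu_{12});\\ &q_{i,i+1}=\lambda,\quad q_{i,i-1}=2\mu,\quad q_{i,i-2}=\mu_{12},\quad q_{ii}=-(\lambda+2\mu+\mu_{12})\qquad (i\ge 2), \end{aligned} \] and all other entries are $0$. That is, $X$ is Markov with a transition function whose derivative at time $0$ is $Q_0$. Moreover $q_{ii}=-\theta_i$ and $q_{ij}=\theta_i p_{ij}$ for $i\ne j$, where the sojourn time in state $i$ is exponential with parameter $\theta_i$ and the embedded jump chain has transition probabilities $p_{ij}$; given the past, the sojourn time in the current state and the next state are independent, and $X$ has almost surely finitely many jumps in every bounded time interval. -/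

import Mathlib

open MeasureTheory ProbabilityTheory Filter Topology
open scoped ENNReal NNReal

/-! ### Continuous-time Markov chains on a countable state space -/

section CTMC

/-- Standard (honest) transition functions on `S`: stochastic matrices `p t`, with `p 0` the
identity, satisfying the Chapman-Kolmogorov equations. -/
structure IsTransitionFunction {S : Type*} (p : ℝ≥0 → S → S → ℝ) : Prop where
  nonneg : ∀ t i j, 0 ≤ p t i j
  sum_one : ∀ t i, HasSum (p t i) 1
  zero_same : ∀ i, p 0 i i = 1
  zero_ne : ∀ i j, i ≠ j → p 0 i j = 0
  chapman_kolmogorov : ∀ s t i j, HasSum (fun k => p s i k * p t k j) (p (s + t) i j)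

/-- `X` is a time-homogeneous continuous-time Markov chain with transition rate matrix `Q`:
there is a transition function `p` whose (right) derivative at time `0` is `Q`, such that for
all times `t 0 ≤ ... ≤ t (n+1)`, the conditional probability of `X (t (n+1)) = i (n+1)` given
`X (t 0) = i 0, ..., X (t n) = i n` is `p (t (n+1) - t n) (i n) (i (n+1))`
(written as a product, so that null conditioning events need no separate treatment). -/
structure IsCTMC {Ω S : Type*} [MeasurableSpace Ω] [MeasurableSpace S] (P : Measure Ω)
    (X : ℝ≥0 → Ω → S) (Q : S → S → ℝ) : Prop where
  measurable : ∀ t, Measurable (X t)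
  markov : ∃ p : ℝ≥0 → S → S → ℝ, IsTransitionFunction p ∧
    (∀ i j, HasDerivWithinAt (fun t : ℝ => p t.toNNReal i j) (Q i j) (Set.Ici 0) 0) ∧
    ∀ (n : ℕ) (t : ℕ → ℝ≥0) (i : ℕ → S), Monotone t →
      P {ω | ∀ k ≤ n + 1, X (t k) ω = i k} =
        P {ω | ∀ k ≤ n, X (t k) ω = i k} *
          ENNReal.ofReal (p (t (n + 1) - t n) (i n) (i (n + 1)))

/-- The process `X` is a pure jump process, without explosion, whose sojourn time in state `i` is
exponential with parameter `θ i` and whose embedded chain has transition matrix `r`: given the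
past, the sojourn time in the current state and the next state are independent, with these laws.
`Y n` is the state after the `n`-th jump and `H n` the sojourn time there. -/
structure HasSojournsAndEmbeddedChain {Ω S : Type*} [MeasurableSpace Ω] [MeasurableSpace S]
    (P : Measure Ω) (X : ℝ≥0 → Ω → S) (θ : S → ℝ) (r : S → S → ℝ) : Prop where
  rate_pos : ∀ i, 0 < θ i
  nonneg : ∀ i j, 0 ≤ r i j
  diag : ∀ i, r i i = 0
  sum_one : ∀ i, HasSum (r i) 1
  jumps : ∃ (Y : ℕ → Ω → S) (H : ℕ → Ω → ℝ),
    (∀ n, Measurable (Y n)) ∧ (∀ n, Measurable (H n)) ∧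
    (∀ᵐ ω ∂P, (∀ n, 0 < H n ω) ∧ (∀ n, Y (n + 1) ω ≠ Y n ω) ∧
      Tendsto (fun n => ∑ k ∈ Finset.range n, H k ω) atTop atTop ∧
      ∀ (n : ℕ) (t : ℝ≥0), ∑ k ∈ Finset.range n, H k ω ≤ t →
        (t : ℝ) < ∑ k ∈ Finset.range (n + 1), H k ω → X t ω = Y n ω) ∧
    ∀ (n : ℕ) (i : ℕ → S) (u : ℕ → ℝ≥0),
      P {ω | (∀ k ≤ n, Y k ω = i k) ∧ ∀ k < n, (u k : ℝ) < H k ω} =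
        P {ω | X 0 ω = i 0} *
          ∏ k ∈ Finset.range n,
            ENNReal.ofReal (r (i k) (i (k + 1)) * Real.exp (-(θ (i k) * u k)))

end CTMC

/-! ### The `M/M_D/2` queue -/

namespace MMD2

/-- Configurations of the system: empty; a single customer, at server `i`; both servers busy and
`q` customers waiting. Servers 1 and 2 are indexed by `0` and `1` in `Fin 2`. -/
inductive Config : Type
  | empty : Config
  | one (i : Fin 2) : Config
  | both (q : ℕ) : Config

instance : MeasurableSpace Config := ⊤

/-- The number of customers in the system. -/
def Config.number : Config → ℕ
  | .empty => 0
  | .one _ => 1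
  | .both q => q + 2

/-- The clocks: interarrival time, the shock `T_i` ending the service at server `i` only, and the
common shock `T_{12}` ending the services at both servers. -/
inductive Clock : Type
  | arrival : Clock
  | single (i : Fin 2) : Clock
  | common : Clock
  deriving DecidableEq

/-- The clocks that run in a given configuration. The common clock runs iff some server is busy. -/
def running : Config → Finset Clock
  | .empty => {.arrival}
  | .one i => {.arrival, .single i, .common}
  | .both _ => {.arrival, .single 0, .single 1, .common}

/-- The configuration after clock `c` rings. The server `b` is used when a customer has to be sent
to one of two free servers. (A customer in the empty system cannot depart.) -/
def next (b : Fin 2) : Config → Clock → Config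
  | .empty, .arrival => .one b
  | .empty, _ => .empty
  | .one _, .arrival => .both 0
  | .one _, _ => .empty
  | .both q, .arrival => .both (q + 1)
  | .both 0, .single i => .one (1 - i)
  | .both (q + 1), .single _ => .both q
  | .both 0, .common => .empty
  | .both 1, .common => .one b
  | .both (q + 2), .common => .both q

/-- The clocks discarded (to be generated afresh at their next use) when clock `c` rings.
The arrival clock is renewed at arrivals. If a single customer departs and leaves the system empty,
its own clock and the common clock are discarded. If both servers are busy, a single shock uses up
only the clock of that server (the other server's clock and the common clock keep running), and a
common shock uses up all three service clocks. -/
def discarded : Config → Clock → Finset Clock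
  | _, .arrival => {.arrival}
  | .empty, _ => ∅
  | .one i, _ => {.single i, .common}
  | .both _, .single i => {.single i}
  | .both _, .common => {.single 0, .single 1, .common}

/-- The instantaneous data of the system: configuration, for every clock the stream of its values
(entry `0`: the remaining time of the current one, which is the full time if it is not yet
running; entries `1, 2, ...`: the future ones), and the stream of server choices. -/
structure Data : Type where
  config : Config
  clocks : Clock → ℕ → ℝ≥0∞
  choices : ℕ → Fin 2

/-- The time until the next event: the minimum of the remaining times of the running clocks. -/
noncomputable def Data.wait (d : Data) : ℝ≥0∞ :=
  (running d.config).inf fun c => d.clocks c 0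

/-- The running clock that rings first (several ring first only with probability zero). -/
noncomputable def Data.ringing (d : Data) : Clock :=
  if d.clocks .arrival 0 = d.wait then .arrival
  else if .common ∈ running d.config ∧ d.clocks .common 0 = d.wait then .common
  else if .single 0 ∈ running d.config ∧ d.clocks (.single 0) 0 = d.wait then .single 0
  else .single 1

/-- The data immediately after the next event: time has elapsed on the running clocks, and the
discarded clocks are replaced by the next ones in their streams. -/
noncomputable def Data.step (d : Data) : Data where
  config := next (d.choices 0) d.config d.ringing
  clocks c k :=
    if c ∈ discarded d.config d.ringing then d.clocks c (k + 1)
    else if c ∈ running d.config ∧ k = 0 then d.clocks c 0 - d.wait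
    else d.clocks c k
  choices k := d.choices (k + 1)

/-- The data after the first `n` events. -/
noncomputable def Data.after (d : Data) (n : ℕ) : Data := Data.step^[n] d

/-- The time of the `n`-th event, with `time 0 = 0`. -/
noncomputable def Data.time (d : Data) (n : ℕ) : ℝ≥0∞ := ∑ k ∈ Finset.range n, (d.after k).wait

open Classical in
/-- The number of customers in the system at time `t`: that after `n` events, if `t` is in
`[time n, time (n + 1))`. (It is `0` if there is no such `n`, i.e. if infinitely many events occur
up to time `t`, which has probability zero.) -/
noncomputable def Data.numberAt (d : Data) (t : ℝ≥0) : ℕ :=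
  if h : ∃ n, d.time n ≤ t ∧ (t : ℝ≥0∞) < d.time (n + 1) then
    (d.after (Nat.find h)).config.number
  else 0

/-- The rates of the clocks. -/
def rate (lam mu1 mu2 mu12 : ℝ) : Clock → ℝ
  | .arrival => lam
  | .single i => if i = 0 then mu1 else mu2
  | .common => mu12

/-- The random input of the `M/M_D/2` queue: an initial configuration `C`, for every clock `c` a
sequence `T c 0, T c 1, ...` of exponential times with the rate of that clock (at rate `0` the
clock never rings), and a sequence of choices `R n`, equal to server 1 with probability `p` and to
server 2 with probability `1 - p`; all these are independent. -/
structure IsInput {Ω : Type*} [MeasurableSpace Ω] (P : Measure Ω) (lam mu1 mu2 mu12 p : ℝ)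
    (C : Ω → Config) (T : Clock → ℕ → Ω → ℝ≥0∞) (R : ℕ → Ω → Fin 2) : Prop where
  measurable_init : Measurable C
  measurable_clock : ∀ c n, Measurable (T c n)
  measurable_choice : ∀ n, Measurable (R n)
  survival : ∀ c n (t : ℝ), 0 ≤ t →
    P {ω | ENNReal.ofReal t < T c n ω} =
      ENNReal.ofReal (Real.exp (-(rate lam mu1 mu2 mu12 c * t)))
  choice : ∀ n, P {ω | R n ω = 0} = ENNReal.ofReal p
  indep_clocks : iIndepFun (fun cn : Clock × ℕ => T cn.1 cn.2) P
  indep_choices : iIndepFun R P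
  indep_clocks_choices :
    IndepFun (fun ω (cn : Clock × ℕ) => T cn.1 cn.2 ω) (fun ω n => R n ω) P
  indep_init :
    IndepFun C (fun ω => ((fun cn : Clock × ℕ => T cn.1 cn.2 ω), fun n => R n ω)) P

/-- The number of customers at time `t` in the `M/M_D/2` queue driven by the input `C`, `T`, `R`. -/
noncomputable def queue {Ω : Type*} (C : Ω → Config) (T : Clock → ℕ → Ω → ℝ≥0∞)
    (R : ℕ → Ω → Fin 2) (t : ℝ≥0) (ω : Ω) : ℕ :=
  Data.numberAt ⟨C ω, fun c n => T c n ω, fun n => R n ω⟩ t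

/-- The transition rate matrix for homogeneous servers. -/
def Q0 (lam mu mu12 : ℝ) : ℕ → ℕ → ℝ
  | 0, j => if j = 0 then -lam else if j = 1 then lam else 0
  | 1, j =>
    if j = 0 then mu + mu12 else if j = 1 then -(lam + mu + mu12) else if j = 2 then lam else 0
  | i + 2, j =>
    if j = i then mu12 else if j = i + 1 then 2 * mu
    else if j = i + 2 then -(lam + 2 * mu + mu12) else if j = i + 3 then lam else 0

end MMD2

/-! The proof rests on the lack of memory of the clocks. An exponential law (possibly the one at
`∞`, for rate `0`) satisfies `Memoryless`, so at a fixed time before the first event the residual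
clocks are again independent and exponential (`clockLaw_age`, `law_age`). The same holds at the
first event: conditionally on which clock `k` rings first and on its value `s`, the surviving
running clocks are conditioned to exceed `s` and are reduced by `s`, hence fresh, while a discarded
clock is replaced by an independent one from its stream (`clockLaw_step`). So the data after an
event is a mixture of the laws `law ρ χ c` with fresh clocks, the weights being ratios of rates
(`law_step`), and the waiting time is independent of it (`law_wait_step`, `indepFun_wait_step`). In
particular it makes no difference whether the common clock is residual or fresh.

The configuration therefore evolves as a Markov chain. With equal servers it is lumpable by the
number of customers: both configurations with one customer have the same total rate, the two single
shocks have equal rates, and the number after an event does not depend on the server chosen. This is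
`law_step_eq_jumpMean`: if the probability of an event depends on the initial configuration only
through the number, the same is true one event later, with the weights of the embedded chain.

Induction on the number of events carries lumpability to fixed times (`exists_law_occupation`,
`law_iUnion_occupation`) and yields the Markov property (`law_numberAt_and`) and the
finite-dimensional laws. Non-explosion follows from the uniform bound on the total rates. The
derivative at `0` comes from comparing with at most one event, since two events within time `t` have
probability `O(t²)` (`abs_transition_sub_le`). The joint law of the sojourn times and the embedded
chain is `law_jumpPath`. Finally, the actual input is a mixture over the initial configuration of
the laws with fresh clocks (`measure_inputData`). -/

/-! ### Streams of independent, identically distributed random elements -/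

section IIDStream

variable {α : Type*}

/-- The sequence with first entry `a`, continued by `x`. -/
def streamCons (a : α) (x : ℕ → α) : ℕ → α
  | 0 => a
  | n + 1 => x n

/-- The sequence without its first entry. -/
def streamTail (x : ℕ → α) : ℕ → α := fun n => x (n + 1)

variable [MeasurableSpace α]

/-- The law of a sequence of independent random elements with law `μ`. -/
noncomputable def iidStream (μ : Measure α) [IsProbabilityMeasure μ] : Measure (ℕ → α) :=
  Measure.infinitePi fun _ : ℕ => μ

instance (μ : Measure α) [IsProbabilityMeasure μ] : IsProbabilityMeasure (iidStream μ) := by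
  unfold iidStream; infer_instance

theorem measurable_streamCons : Measurable fun z : α × (ℕ → α) => streamCons z.1 z.2 := by
  refine measurable_pi_lambda _ fun n => ?_
  cases n with
  | zero => exact measurable_fst
  | succ n => exact (measurable_pi_apply n).comp measurable_snd

theorem measurable_streamTail : Measurable (streamTail : (ℕ → α) → ℕ → α) :=
  measurable_pi_lambda _ fun n => measurable_pi_apply (n + 1)

/-- An infinite product measure is determined by boxes over finite index sets. Such a set is
enlarged to an initial segment, with trivial constraints on the added indices, so that index `0`
splits off. -/
theorem iidStream_map_cons (μ : Measure α) [IsProbabilityMeasure μ] :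
    (μ.prod (iidStream μ)).map (fun z : α × (ℕ → α) => streamCons z.1 z.2) = iidStream μ := by
  classical
  refine Measure.eq_infinitePi _ fun s t ht => ?_
  set t' : ℕ → Set α := fun i => if i ∈ s then t i else Set.univ with ht'
  have mt' : ∀ i, MeasurableSet (t' i) := fun i => by
    by_cases h : i ∈ s <;> simp [ht', h, ht]
  obtain ⟨N, hN⟩ : ∃ N, s ⊆ Finset.range (N + 1) :=
    ⟨s.sup id, fun i hi => Finset.mem_range.2 (Nat.lt_succ_of_le (Finset.le_sup (f := id) hi))⟩
  have hset : (s : Set ℕ).pi t = ((Finset.range (N + 1) : Finset ℕ) : Set ℕ).pi t' := by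
    ext x
    simp only [Set.mem_pi, Finset.mem_coe, ht']
    constructor
    · intro h i _
      by_cases hi : i ∈ s
      · simpa [hi] using h i hi
      · simp [hi]
    · intro h i hi
      simpa [hi] using h i (hN hi)
  have hprod : ∏ i ∈ s, μ (t i) = ∏ i ∈ Finset.range (N + 1), μ (t' i) := by
    rw [← Finset.prod_subset hN]
    · exact Finset.prod_congr rfl fun i hi => by simp [ht', hi]
    · intro i _ hi
      simp [ht', hi]
  rw [hset, hprod, Measure.map_apply measurable_streamCons
    (.pi (Finset.countable_toSet _) fun i _ => mt' i)]
  have : (fun z : α × (ℕ → α) => streamCons z.1 z.2) ⁻¹'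
      ((Finset.range (N + 1) : Finset ℕ) : Set ℕ).pi t' =
      t' 0 ×ˢ ((Finset.range N : Finset ℕ) : Set ℕ).pi (fun i => t' (i + 1)) := by
    ext ⟨a, x⟩
    simp only [Set.mem_preimage, Set.mem_pi, Finset.mem_coe, Finset.mem_range, Set.mem_prod]
    constructor
    · intro h
      exact ⟨h 0 (Nat.succ_pos _), fun i hi => h (i + 1) (Nat.succ_lt_succ hi)⟩
    · rintro ⟨h0, h⟩ i hi
      cases i with
      | zero => exact h0
      | succ i => exact h i (Nat.lt_of_succ_lt_succ hi)
  rw [this, Measure.prod_prod, iidStream, Measure.infinitePi_pi _ fun i _ => mt' (i + 1),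
    Finset.prod_range_succ', mul_comm]

/-- The head and the tail of an i.i.d. sequence. -/
theorem iidStream_map_head_tail (μ : Measure α) [IsProbabilityMeasure μ] :
    (iidStream μ).map (fun x => (x 0, streamTail x)) = μ.prod (iidStream μ) := by
  conv_lhs => rw [← iidStream_map_cons]
  rw [Measure.map_map ((measurable_pi_apply 0).prodMk measurable_streamTail)
    measurable_streamCons]
  exact Measure.map_id

theorem measurePreserving_head_tail (μ : Measure α) [IsProbabilityMeasure μ] :
    MeasurePreserving (fun x : ℕ → α => (x 0, streamTail x)) (iidStream μ)
      (μ.prod (iidStream μ)) :=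
  ⟨(measurable_pi_apply 0).prodMk measurable_streamTail, iidStream_map_head_tail μ⟩

theorem measurePreserving_head (μ : Measure α) [IsProbabilityMeasure μ] :
    MeasurePreserving (fun x : ℕ → α => x 0) (iidStream μ) μ :=
  measurePreserving_eval_infinitePi (fun _ : ℕ => μ) 0

theorem iidStream_head_inter_tail (μ : Measure α) [IsProbabilityMeasure μ] {B : Set α}
    (hB : MeasurableSet B) {A : Set (ℕ → α)} (hA : MeasurableSet A) :
    iidStream μ {x | x 0 ∈ B ∧ streamTail x ∈ A} = μ B * iidStream μ A := by
  rw [← Measure.prod_prod, ← iidStream_map_head_tail,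
    Measure.map_apply (measurePreserving_head_tail μ).measurable (hB.prod hA)]
  rfl

end IIDStream

/-- This lets an independent second coordinate, later the stream of choices, be carried along while
the first is conditioned and transformed. -/
theorem MeasureTheory.Measure.prod_restrict_map_fst {α β γ : Type*} [MeasurableSpace α]
    [MeasurableSpace β] [MeasurableSpace γ] {μ : Measure α} [SFinite μ] {ν : Measure β} [SFinite ν]
    {B : Set α} (hB : MeasurableSet B) {f : α → γ} (hf : Measurable f) {A : Set (γ × β)}
    (hA : MeasurableSet A) :
    μ.prod ν {z | z.1 ∈ B ∧ (f z.1, z.2) ∈ A} = ((μ.restrict B).map f).prod ν A := by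
  have hA' : MeasurableSet {z : α × β | z.1 ∈ B ∧ (f z.1, z.2) ∈ A} :=
    (measurable_fst hB).inter (((hf.comp measurable_fst).prodMk measurable_snd) hA)
  rw [Measure.prod_apply hA', Measure.prod_apply hA,
    lintegral_map (measurable_measure_prodMk_left hA) hf, ← lintegral_indicator hB]
  refine lintegral_congr fun a => ?_
  by_cases ha : a ∈ B
  · simp only [ha, Set.indicator_of_mem, Set.preimage, Set.mem_ofPred_eq, true_and]
  · simp only [ha, Set.preimage, Set.mem_ofPred_eq, false_and, Set.indicator_of_notMem,
      not_false_eq_true, Set.ofPred_false, measure_empty]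

/-! ### Memoryless laws -/

section Memoryless

/-- A law on `[0, ∞]` without memory: the residual time after `s`, on the event that `s` is
exceeded, is distributed as the time itself. -/
def Memoryless (μ : Measure ℝ≥0∞) : Prop :=
  ∀ s, (μ.restrict (Set.Ioi s)).map (fun x => x - s) = μ (Set.Ioi s) • μ

/-- The first entry of the sequence is reduced by `s`. -/
def ageStream (s : ℝ≥0∞) (x : ℕ → ℝ≥0∞) : ℕ → ℝ≥0∞ := fun n => if n = 0 then x 0 - s else x n

theorem ageStream_eq (s : ℝ≥0∞) (x : ℕ → ℝ≥0∞) :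
    ageStream s x = streamCons (x 0 - s) (streamTail x) := by
  funext n; cases n <;> rfl

theorem measurable_ageStream :
    Measurable fun z : ℝ≥0∞ × (ℕ → ℝ≥0∞) => ageStream z.1 z.2 := by
  simp only [ageStream_eq]
  refine measurable_streamCons.comp (.prodMk (.sub ?_ measurable_fst) ?_)
  · exact (measurable_pi_apply 0).comp measurable_snd
  · exact measurable_streamTail.comp measurable_snd

/-- Conditioning and ageing touch only the head of the stream, which is independent of the tail. -/
theorem Memoryless.iidStream_age {μ : Measure ℝ≥0∞} [IsProbabilityMeasure μ] (hμ : Memoryless μ)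
    (s : ℝ≥0∞) {A : Set (ℕ → ℝ≥0∞)} (hA : MeasurableSet A) :
    iidStream μ {x | s < x 0 ∧ ageStream s x ∈ A} = μ (Set.Ioi s) * iidStream μ A := by
  have hsub : Measurable fun x : ℝ≥0∞ => x - s := by fun_prop
  have hm : MeasurableSet {z : ℝ≥0∞ × (ℕ → ℝ≥0∞) | streamCons z.1 z.2 ∈ A} :=
    measurable_streamCons hA
  have hm' : MeasurableSet {z : ℝ≥0∞ × (ℕ → ℝ≥0∞) | streamCons (z.1 - s) z.2 ∈ A} :=
    ((hsub.comp measurable_fst).prodMk measurable_snd) hm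
  have hI : MeasurableSet {z : ℝ≥0∞ × (ℕ → ℝ≥0∞) | s < z.1} :=
    measurableSet_lt measurable_const measurable_fst
  have h1 : iidStream μ {x | s < x 0 ∧ ageStream s x ∈ A} =
      (μ.prod (iidStream μ)) ({z | s < z.1} ∩ {z | streamCons (z.1 - s) z.2 ∈ A}) := by
    rw [← iidStream_map_head_tail,
      Measure.map_apply (measurePreserving_head_tail μ).measurable (hI.inter hm')]
    simp only [ageStream_eq]
    rfl
  have h2 : (μ.prod (iidStream μ)) ({z | s < z.1} ∩ {z | streamCons (z.1 - s) z.2 ∈ A}) =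
      (((μ.restrict (Set.Ioi s)).map (fun x => x - s)).prod (iidStream μ))
        {z | streamCons z.1 z.2 ∈ A} :=
    Measure.prod_restrict_map_fst measurableSet_Ioi hsub hm
  have h3 : (μ.prod (iidStream μ)) {z | streamCons z.1 z.2 ∈ A} = iidStream μ A := by
    conv_rhs => rw [← iidStream_map_cons, Measure.map_apply measurable_streamCons hA]
    rfl
  rw [h1, h2, hμ s, Measure.prod_smul_left, Measure.smul_apply, h3, smul_eq_mul]

/-- Finite thresholds suffice because the ray beyond `⊤` is empty. An atom at `⊤`, as for a clock of
rate `0`, is accounted for by the total mass. -/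
theorem ENNReal.measure_ext_of_Ioi_ofReal {μ ν : Measure ℝ≥0∞} [IsFiniteMeasure μ]
    (hu : μ Set.univ = ν Set.univ)
    (h : ∀ t : ℝ, 0 ≤ t → μ (Set.Ioi (ENNReal.ofReal t)) = ν (Set.Ioi (ENNReal.ofReal t))) :
    μ = ν := by
  have : IsFiniteMeasure ν := ⟨hu ▸ measure_lt_top μ _⟩
  refine Measure.ext_of_Iic μ ν fun a => ?_
  have h' : μ (Set.Ioi a) = ν (Set.Ioi a) := by
    by_cases ha : a = ⊤
    · simp [ha]
    · rw [← ENNReal.ofReal_toReal ha]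
      exact h _ ENNReal.toReal_nonneg
  rw [← Set.compl_Ioi, measure_compl measurableSet_Ioi (measure_ne_top _ _),
    measure_compl measurableSet_Ioi (measure_ne_top _ _), hu, h']

end Memoryless

/-! ### Exponential laws on `[0, ∞]` -/

section ExpLaw

/-- The exponential law with rate `r ≥ 0` on `[0, ∞]`; for `r = 0` it is concentrated at `∞`. -/
def HasExpLaw (r : ℝ) (μ : Measure ℝ≥0∞) : Prop :=
  ∀ t : ℝ, 0 ≤ t → μ (Set.Ioi (ENNReal.ofReal t)) = ENNReal.ofReal (Real.exp (-(r * t)))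

theorem HasExpLaw.unique {r : ℝ} {μ ν : Measure ℝ≥0∞} [IsProbabilityMeasure μ]
    [IsProbabilityMeasure ν] (hμ : HasExpLaw r μ) (hν : HasExpLaw r ν) : μ = ν :=
  ENNReal.measure_ext_of_Ioi_ofReal (by simp) fun t ht => by rw [hμ t ht, hν t ht]

/-- This is the functional equation of the exponential function: for finite `s`, exceeding `s` with
a residual above `t` means exceeding `t + s`. For `s = ⊤` both sides vanish. -/
theorem HasExpLaw.memoryless {r : ℝ} {μ : Measure ℝ≥0∞} [IsProbabilityMeasure μ]
    (hμ : HasExpLaw r μ) : Memoryless μ := by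
  intro s
  have hsub : Measurable fun x : ℝ≥0∞ => x - s := by fun_prop
  refine ENNReal.measure_ext_of_Ioi_ofReal ?_ fun t ht => ?_
  · rw [Measure.map_apply hsub MeasurableSet.univ]; simp
  · rw [Measure.map_apply hsub measurableSet_Ioi,
      Measure.restrict_apply (hsub measurableSet_Ioi), Measure.smul_apply, smul_eq_mul]
    by_cases hs : s = ⊤
    · simp [hs]
    have hs' : s = ENNReal.ofReal s.toReal := (ENNReal.ofReal_toReal hs).symm
    have : (fun x : ℝ≥0∞ => x - s) ⁻¹' Set.Ioi (ENNReal.ofReal t) ∩ Set.Ioi s =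
        Set.Ioi (ENNReal.ofReal (t + s.toReal)) := by
      rw [ENNReal.ofReal_add ht ENNReal.toReal_nonneg, ← hs']
      ext x
      simp only [Set.mem_inter_iff, Set.mem_preimage, Set.mem_Ioi, lt_tsub_iff_right]
      exact ⟨fun h => h.1, fun h => ⟨h, lt_of_le_of_lt le_add_self h⟩⟩
    rw [this, hμ _ (add_nonneg ht ENNReal.toReal_nonneg), hμ t ht]
    conv_rhs => rw [hs', hμ _ ENNReal.toReal_nonneg]
    rw [← ENNReal.ofReal_mul (Real.exp_nonneg _), ← Real.exp_add]
    congr 2; ring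

theorem HasExpLaw.map_expMeasure {r : ℝ} (hr : 0 < r) :
    HasExpLaw r ((expMeasure r).map ENNReal.ofReal) := by
  intro t ht
  have := isProbabilityMeasure_expMeasure hr
  rw [Measure.map_apply ENNReal.measurable_ofReal measurableSet_Ioi]
  have h1 : ENNReal.ofReal ⁻¹' Set.Ioi (ENNReal.ofReal t) = (Set.Iic t)ᶜ := by
    ext x
    simp only [Set.mem_preimage, Set.mem_Ioi, Set.mem_compl_iff, Set.mem_Iic, not_le]
    constructor
    · intro h; by_contra hx
      exact absurd h (not_lt.2 (ENNReal.ofReal_le_ofReal (not_lt.1 hx)))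
    · intro h; exact (ENNReal.ofReal_lt_ofReal_iff (lt_of_le_of_lt ht h)).2 h
  rw [h1, ← ENNReal.ofReal_toReal (measure_ne_top (expMeasure r) _)]
  congr 1
  have h2 := cdf_expMeasure_eq hr t
  rw [if_pos ht, cdf_eq_real, measureReal_def] at h2
  rw [prob_compl_eq_one_sub measurableSet_Iic, ENNReal.toReal_sub_of_le prob_le_one (by simp), h2]
  simp

theorem HasExpLaw.ae_eq_top {μ : Measure ℝ≥0∞} [IsProbabilityMeasure μ] (hμ : HasExpLaw 0 μ) :
    ∀ᵐ x ∂μ, x = ⊤ := by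
  have h : ∀ n : ℕ, ∀ᵐ x ∂μ, (n : ℝ≥0∞) < x := fun n => by
    have h1 := hμ n n.cast_nonneg
    simp only [zero_mul, neg_zero, Real.exp_zero, ENNReal.ofReal_one, ENNReal.ofReal_natCast] at h1
    exact (mem_ae_iff_prob_eq_one measurableSet_Ioi).2 h1
  filter_upwards [ae_all_iff.2 h] with x hx
  by_contra hx'
  obtain ⟨n, hn⟩ := ENNReal.exists_nat_gt hx'
  exact absurd (hx n) (not_lt.2 hn.le)

/-- The probability that a clock of rate `r` rings before an independent clock of rate `a`. -/
theorem HasExpLaw.lintegral_survival {r a : ℝ} (hr : 0 ≤ r) (ha : 0 ≤ a) (hra : 0 < r + a)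
    {μ : Measure ℝ≥0∞} [IsProbabilityMeasure μ] (hμ : HasExpLaw r μ) {f : ℝ≥0∞ → ℝ≥0∞}
    (hf : Measurable f) (hfa : ∀ t : ℝ, 0 ≤ t →
      f (ENNReal.ofReal t) = ENNReal.ofReal (Real.exp (-(a * t))))
    (hf_top : r = 0 → f ⊤ = 0) :
    ∫⁻ x, f x ∂μ = ENNReal.ofReal (r / (r + a)) := by
  -- At rate `0` the law sits at `⊤`, so only the value of `f` there counts.
  rcases hr.eq_or_lt with rfl | hr
  · rw [lintegral_congr_ae (g := fun _ => 0)]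
    · simp
    · filter_upwards [hμ.ae_eq_top] with x hx
      rw [hx, hf_top rfl]
  · have := isProbabilityMeasure_expMeasure hr
    have : IsProbabilityMeasure ((expMeasure r).map ENNReal.ofReal) :=
      Measure.isProbabilityMeasure_map (by fun_prop)
    rw [hμ.unique (HasExpLaw.map_expMeasure hr), lintegral_map hf ENNReal.measurable_ofReal]
    have hpdf : Measurable (exponentialPDF r) :=
      (measurable_exponentialPDFReal r).ennreal_ofReal
    have : expMeasure r = volume.withDensity (exponentialPDF r) := rfl
    rw [this, lintegral_withDensity_eq_lintegral_mul (g := fun x => f (ENNReal.ofReal x)) _ hpdf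
      (hf.comp ENNReal.measurable_ofReal)]
    -- The product of `r e^{-rx}` and `e^{-ax}` is `r / (r + a)` times the density of rate `r + a`,
    -- whose integral is one.
    have : ∀ x, (exponentialPDF r * fun x => f (ENNReal.ofReal x)) x =
        ENNReal.ofReal (r / (r + a)) * exponentialPDF (r + a) x := fun x => by
      rw [Pi.mul_apply]
      by_cases hx : 0 ≤ x
      · rw [exponentialPDF_of_nonneg hx, exponentialPDF_of_nonneg hx, hfa x hx,
          ← ENNReal.ofReal_mul (by positivity), ← ENNReal.ofReal_mul (by positivity)]
        congr 1
        rw [mul_assoc, ← Real.exp_add]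
        field_simp
        congr 1; ring
      · rw [exponentialPDF_of_neg (not_le.1 hx), exponentialPDF_of_neg (not_le.1 hx)]
        simp
    simp_rw [this]
    rw [lintegral_const_mul' _ _ ENNReal.ofReal_ne_top, lintegral_exponentialPDF_eq_one hra,
      mul_one]

end ExpLaw

/-! ### Finite product measures -/

section Pi

variable {ι : Type*} [Fintype ι] {X : ι → Type*} [∀ i, MeasurableSpace (X i)]

/-- A finite measure which is a multiple of a product measure on boxes is that multiple. -/
theorem eq_smul_pi (μ : ∀ i, Measure (X i)) [∀ i, IsProbabilityMeasure (μ i)]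
    {ν : Measure (∀ i, X i)} [IsFiniteMeasure ν] {a : ℝ≥0∞}
    (h : ∀ s : ∀ i, Set (X i), (∀ i, MeasurableSet (s i)) →
      ν (Set.univ.pi s) = a * ∏ i, μ i (s i)) : ν = a • Measure.pi μ := by
  refine ext_of_generate_finite _ generateFrom_pi.symm isPiSystem_pi ?_ ?_
  · rintro _ ⟨s, hs, rfl⟩
    rw [h s fun i => hs i (Set.mem_univ i), Measure.smul_apply, Measure.pi_pi, smul_eq_mul]
  · have := h (fun _ => Set.univ) fun _ => MeasurableSet.univ
    rw [Set.pi_univ] at this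
    rw [this, Measure.smul_apply, smul_eq_mul]
    simp

/-- Fubini's theorem for sets whose sections over the coordinate `k` are boxes. -/
theorem pi_sections [DecidableEq ι] (μ : ∀ i, Measure (X i)) [∀ i, IsProbabilityMeasure (μ i)] (k : ι)
    {B : Set (X k)} (hB : MeasurableSet B) (U : ∀ i, X k → Set (X i))
    (hU : ∀ i, MeasurableSet {z : X k × X i | z.2 ∈ U i z.1}) :
    Measure.pi μ {x | x k ∈ B ∧ ∀ i, i ≠ k → x i ∈ U i (x k)} =
      ∫⁻ y in B, ∏ i ∈ Finset.univ.erase k, μ i (U i y) ∂μ k := by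
  -- Coordinate `k` is split off; over each of its values the section in the other coordinates is a
  -- box.
  have hmp : MeasurePreserving (MeasurableEquiv.piEquivPiSubtypeProd X fun i => i = k)
      (Measure.pi μ) ((Measure.pi fun i : {i // i = k} => μ i).prod
        (Measure.pi fun i : {i // ¬ i = k} => μ i)) := by
    convert measurePreserving_piEquivPiSubtypeProd μ (fun i => i = k)
  have hk := measurePreserving_piUnique (fun i : {i // i = k} => μ i)
  set V : Set (X k × (∀ i : {i // ¬ i = k}, X i)) :=
    {z | z.1 ∈ B ∧ ∀ i : {i // ¬ i = k}, z.2 i ∈ U i z.1} with hV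
  have hVm : MeasurableSet V := by
    have : V = (Prod.fst ⁻¹' B) ∩ ⋂ i : {i // ¬ i = k},
        {z : X k × (∀ i : {i // ¬ i = k}, X i) | z.2 i ∈ U i z.1} := by
      ext; simp [hV]
    rw [this]
    refine (measurable_fst hB).inter (MeasurableSet.iInter fun i => ?_)
    have hi : Measurable fun z : X k × (∀ i : {i // ¬ i = k}, X i) => (z.1, z.2 i) :=
      measurable_fst.prodMk ((measurable_pi_apply i).comp measurable_snd)
    exact hi (hU i)
  have h1 := (hk.prod (MeasurePreserving.id (Measure.pi fun i : {i // ¬ i = k} => μ i))).comp hmp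
  have h2 := h1.measure_preimage (s := V) hVm.nullMeasurableSet
  have h3 : (Measure.pi μ) {x | x k ∈ B ∧ ∀ i, i ≠ k → x i ∈ U i (x k)} =
      ((μ k).prod (Measure.pi fun i : {i // ¬ i = k} => μ i)) V := by
    refine Eq.trans ?_ h2
    congr 1
    ext x
    exact ⟨fun h => ⟨h.1, fun i => h.2 i i.2⟩, fun h => ⟨h.1, fun i hi => h.2 ⟨i, hi⟩⟩⟩
  rw [h3, Measure.prod_apply hVm, ← lintegral_indicator hB]
  refine lintegral_congr fun y => ?_
  by_cases hy : y ∈ B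
  · rw [Set.indicator_of_mem hy]
    have : Prod.mk y ⁻¹' V = Set.univ.pi fun i : {i // ¬ i = k} => U i y := by
      ext z; simp [hV, hy]
    rw [this, Measure.pi_pi, Finset.prod_subtype (Finset.univ.erase k) (p := fun i => ¬ i = k)
      (by simp)]
  · rw [Set.indicator_of_notMem hy]
    have : Prod.mk y ⁻¹' V = ∅ := by ext z; simp [hV, hy]
    rw [this, measure_empty]

end Pi

namespace MMD2

/-! ### The spaces of clocks, configurations and data -/

instance : Fintype Clock where
  elems := {.arrival, .single 0, .single 1, .common}
  complete c := by
    cases c with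
    | single i => fin_cases i <;> simp
    | _ => simp

instance : MeasurableSpace Clock := ⊤

instance : DiscreteMeasurableSpace Clock := ⟨fun _ => trivial⟩

instance : DiscreteMeasurableSpace Config := ⟨fun _ => trivial⟩

instance : Countable Config := by
  refine Function.Injective.countable (β := Option (Fin 2 ⊕ ℕ)) (f := fun c => match c with
    | .empty => none
    | .one i => some (.inl i)
    | .both q => some (.inr q)) ?_
  intro a b h
  cases a <;> cases b <;> simp_all

instance : MeasurableSpace Data :=
  MeasurableSpace.comap (fun d => (d.config, d.clocks, d.choices)) inferInstance

section Measurability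

variable {β : Type*} [MeasurableSpace β]

theorem measurable_data_parts : Measurable fun d : Data => (d.config, d.clocks, d.choices) :=
  comap_measurable _

theorem measurable_config : Measurable Data.config := measurable_fst.comp measurable_data_parts

theorem measurable_clocks : Measurable Data.clocks :=
  (measurable_fst.comp measurable_snd).comp measurable_data_parts

theorem measurable_clock (c : Clock) (k : ℕ) : Measurable fun d : Data => d.clocks c k :=
  (measurable_pi_apply k).comp ((measurable_pi_apply c).comp measurable_clocks)

theorem measurable_choices : Measurable Data.choices :=
  (measurable_snd.comp measurable_snd).comp measurable_data_parts

theorem measurable_choice (k : ℕ) : Measurable fun d : Data => d.choices k :=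
  (measurable_pi_apply k).comp measurable_choices

theorem measurable_data_iff {f : β → Data} : Measurable f ↔ Measurable (fun b => (f b).config) ∧
    (∀ c k, Measurable fun b => (f b).clocks c k) ∧ ∀ k, Measurable fun b => (f b).choices k := by
  constructor
  · intro h
    exact ⟨measurable_config.comp h, fun c k => (measurable_clock c k).comp h,
      fun k => (measurable_choice k).comp h⟩
  · rintro ⟨h1, h2, h3⟩
    refine measurable_comap_iff.2 (h1.prodMk (.prodMk ?_ (measurable_pi_lambda _ h3)))
    exact measurable_pi_lambda _ fun c => measurable_pi_lambda _ fun k => h2 c k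

theorem measurable_wait : Measurable Data.wait := by
  have h : Measurable fun z : Config × (Clock → ℝ≥0∞) => (running z.1).inf z.2 := by
    refine measurable_from_prod_countable_right fun c => ?_
    have h : ∀ s : Finset Clock, Measurable fun x : Clock → ℝ≥0∞ => s.inf x := fun s => by
      induction s using Finset.induction_on with
      | empty => simp
      | insert a s _ ih => simp only [Finset.inf_insert]; exact (measurable_pi_apply a).inf ih
    exact h (running c)
  exact h.comp (measurable_config.prodMk
    (measurable_pi_lambda (fun (d : Data) c => d.clocks c 0) fun c => measurable_clock c 0))

theorem measurableSet_config (p : Config → Prop) : MeasurableSet {d : Data | p d.config} :=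
  measurable_config (MeasurableSet.of_discrete (s := {c | p c}))

theorem measurable_ringing : Measurable Data.ringing := by
  have h : ∀ c, MeasurableSet {d : Data | d.clocks c 0 = d.wait} := fun c =>
    measurableSet_eq_fun (measurable_clock c 0) measurable_wait
  unfold Data.ringing
  refine Measurable.ite (h _) measurable_const (Measurable.ite ?_ measurable_const
    (Measurable.ite ?_ measurable_const measurable_const))
  · exact (measurableSet_config fun c => .common ∈ running c).inter (h _)
  · exact (measurableSet_config fun c => .single 0 ∈ running c).inter (h _)

theorem measurable_step : Measurable Data.step := by
  refine measurable_data_iff.2 ⟨?_, fun c k => ?_, fun k => measurable_choice (k + 1)⟩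
  · have h : Measurable fun z : Fin 2 × Config × Clock => next z.1 z.2.1 z.2.2 :=
      measurable_of_countable _
    exact h.comp ((measurable_choice 0).prodMk (measurable_config.prodMk measurable_ringing))
  · have h : MeasurableSet {d : Data | c ∈ discarded d.config d.ringing} :=
      (measurable_config.prodMk measurable_ringing)
        (MeasurableSet.of_discrete (s := {z : Config × Clock | c ∈ discarded z.1 z.2}))
    exact Measurable.ite h (measurable_clock c (k + 1)) (Measurable.ite
      (measurableSet_config fun c' => c ∈ running c' ∧ k = 0) ((measurable_clock c 0).sub measurable_wait) (measurable_clock c k))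

theorem measurable_after (n : ℕ) : Measurable fun d : Data => d.after n :=
  measurable_step.iterate n

theorem measurable_time (n : ℕ) : Measurable fun d : Data => d.time n :=
  Finset.measurable_sum _ fun k _ => measurable_wait.comp (measurable_after k)

theorem measurable_number : Measurable fun d : Data => d.config.number :=
  (measurable_of_countable Config.number).comp measurable_config

end Measurability

/-! ### The evolution of the data -/

section Evolution

/-- The data after time `t`, if no event occurs up to time `t`. -/
noncomputable def Data.age (t : ℝ≥0∞) (d : Data) : Data where
  config := d.config
  clocks c := if c ∈ running d.config then ageStream t (d.clocks c) else d.clocks c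
  choices := d.choices

theorem Data.age_clocks (t : ℝ≥0∞) (d : Data) (c : Clock) (k : ℕ) :
    (d.age t).clocks c k =
      if c ∈ running d.config ∧ k = 0 then d.clocks c 0 - t else d.clocks c k := by
  by_cases h : c ∈ running d.config <;> by_cases hk : k = 0 <;> simp [Data.age, ageStream, h, hk]

theorem measurable_age : Measurable fun z : ℝ≥0∞ × Data => z.2.age z.1 := by
  refine measurable_data_iff.2 ⟨measurable_config.comp (f := fun z : ℝ≥0∞ × Data => z.2) measurable_snd,
    fun c k => ?_,
    fun k => (measurable_choice k).comp (f := fun z : ℝ≥0∞ × Data => z.2) measurable_snd⟩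
  simp only [Data.age_clocks]
  exact Measurable.ite (measurable_snd (measurableSet_config fun c' => c ∈ running c' ∧ k = 0))
    (((measurable_clock c 0).comp measurable_snd).sub measurable_fst)
    ((measurable_clock c k).comp measurable_snd)

theorem arrival_mem_running (c : Config) : .arrival ∈ running c := by
  cases c <;> simp [running]

theorem Data.wait_le {d : Data} {c : Clock} (hc : c ∈ running d.config) :
    d.wait ≤ d.clocks c 0 := Finset.inf_le hc

theorem Data.lt_wait_iff {d : Data} {t : ℝ≥0∞} :
    t < d.wait ↔ ∀ c ∈ running d.config, t < d.clocks c 0 := by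
  constructor
  · exact fun h c hc => h.trans_le (d.wait_le hc)
  · intro h
    exact (Finset.lt_inf_iff ((h _ (arrival_mem_running _)).trans_le le_top)).2 h

theorem Data.wait_age {d : Data} {t : ℝ≥0∞} (h : t ≠ ⊤) : (d.age t).wait = d.wait - t := by
  -- Subtracting `t` is monotone, so it commutes with finite minima. Finiteness of `t` is needed for
  -- the empty minimum: `⊤ - t = ⊤`.
  have h1 := Finset.apply_inf_eq_inf_comp_of_linearOrder (s := running d.config)
    (f := fun c => d.clocks c 0) (fun x : ℝ≥0∞ => x - t)
    (fun _ _ hab => tsub_le_tsub_right hab t) (by simp [h])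
  rw [Data.wait, Data.wait, h1]
  refine Finset.inf_congr rfl fun c hc => ?_
  rw [Data.age_clocks, if_pos ⟨hc, rfl⟩]
  rfl

theorem Data.ringing_age {d : Data} {t : ℝ≥0∞} (h : t < d.wait) :
    (d.age t).ringing = d.ringing := by
  have h' : t ≠ ⊤ := h.ne_top
  have key : ∀ c ∈ running d.config, ((d.age t).clocks c 0 = (d.age t).wait ↔
      d.clocks c 0 = d.wait) := fun c hc => by
    rw [Data.age_clocks, if_pos ⟨hc, rfl⟩, Data.wait_age h']
    constructor
    · intro h2
      have := congrArg (· + t) h2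
      simpa [tsub_add_cancel_of_le (h.le.trans (d.wait_le hc)), tsub_add_cancel_of_le h.le]
        using this
    · intro h2; rw [h2]
  have key' : ∀ c, (c ∈ running (d.age t).config ∧ (d.age t).clocks c 0 = (d.age t).wait ↔
      c ∈ running d.config ∧ d.clocks c 0 = d.wait) := fun c =>
    and_congr_right fun hc => key c hc
  unfold Data.ringing
  simp only [key', key _ (arrival_mem_running _)]

/-- Ageing changes neither the clock that rings first nor the residuals at the event, since `(x - t)
- (w - t) = x - w` for `t ≤ w`. The next event looks the same from any earlier moment of the waiting
period. -/
theorem Data.step_age {d : Data} {t : ℝ≥0∞} (h : t < d.wait) : (d.age t).step = d.step := by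
  have h1 := Data.ringing_age h
  unfold Data.step
  rw [h1]
  congr 1
  funext c k
  simp only [Data.age_clocks]
  by_cases h2 : c ∈ discarded d.config d.ringing
  · simp [Data.age, h2]
  · by_cases h3 : c ∈ running d.config ∧ k = 0
    · simp only [Data.age, h2, h3, if_true, if_false, and_self]
      have := Data.wait_age (d := d) h.ne_top
      rw [Data.age] at this
      rw [this, tsub_tsub, add_tsub_cancel_of_le h.le]
    · simp only [Data.age, h2, h3, if_false]

theorem Data.after_zero (d : Data) : d.after 0 = d := rfl

theorem Data.after_succ (d : Data) (n : ℕ) : d.after (n + 1) = d.step.after n := rfl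

theorem Data.after_succ' (d : Data) (n : ℕ) : d.after (n + 1) = (d.after n).step :=
  Function.iterate_succ_apply' _ _ _

theorem Data.time_zero (d : Data) : d.time 0 = 0 := rfl

theorem Data.time_succ (d : Data) (n : ℕ) : d.time (n + 1) = d.wait + d.step.time n := by
  rw [Data.time, Finset.sum_range_succ', add_comm]
  rfl

theorem Data.time_succ' (d : Data) (n : ℕ) : d.time (n + 1) = d.time n + (d.after n).wait :=
  Finset.sum_range_succ _ _

theorem Data.time_mono (d : Data) : Monotone d.time :=
  monotone_nat_of_le_succ fun n => by rw [d.time_succ']; exact le_self_add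

theorem Data.ringing_mem (d : Data) : d.ringing ∈ running d.config := by
  unfold Data.ringing
  split_ifs with h1 h2 h3
  · exact arrival_mem_running _
  · exact h2.1
  · exact h3.1
  · obtain ⟨c, hc, hc'⟩ := Finset.exists_mem_eq_inf (running d.config)
      ⟨_, arrival_mem_running _⟩ (fun c => d.clocks c 0)
    change d.wait = _ at hc'
    cases c with
    | arrival => exact absurd hc'.symm h1
    | common => exact absurd ⟨hc, hc'.symm⟩ h2
    | single i =>
      fin_cases i
      · exact absurd ⟨hc, hc'.symm⟩ h3
      · exact hc

/-- Events are thus genuine jumps of the number of customers, so sojourn times of the number are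
waiting times between events. The hypothesis on `k` excludes departures from the empty system. -/
theorem number_next_ne (b : Fin 2) {c : Config} {k : Clock} (hk : k ∈ running c) :
    (next b c k).number ≠ c.number := by
  match c, k with
  | .empty, .arrival => simp [next, Config.number]
  | .empty, .single _ => simp [running] at hk
  | .empty, .common => simp [running] at hk
  | .one _, .arrival => simp [next, Config.number]
  | .one _, .single _ => simp [next, Config.number]
  | .one _, .common => simp [next, Config.number]
  | .both q, .arrival => simp [next, Config.number]
  | .both 0, .single _ => simp [next, Config.number]
  | .both (q + 1), .single _ => simp [next, Config.number]
  | .both 0, .common => simp [next, Config.number]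
  | .both 1, .common => simp [next, Config.number]
  | .both (q + 2), .common => simp [next, Config.number]

theorem Data.number_step_ne (d : Data) : d.step.config.number ≠ d.config.number :=
  number_next_ne _ d.ringing_mem

/-- With a strict minimum the tie-breaking order in `Data.ringing` plays no role. -/
theorem Data.ringing_eq_of_lt {d : Data} {k : Clock} (hk : k ∈ running d.config)
    (h : ∀ c ∈ running d.config, c ≠ k → d.clocks k 0 < d.clocks c 0) :
    d.ringing = k ∧ d.wait = d.clocks k 0 := by
  have hw : d.wait = d.clocks k 0 := by
    refine le_antisymm (d.wait_le hk) (Finset.le_inf fun c hc => ?_)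
    by_cases hck : c = k
    · rw [hck]
    · exact (h c hc hck).le
  refine ⟨?_, hw⟩
  by_contra hne
  have hr : d.clocks d.ringing 0 = d.wait := by
    obtain ⟨c, hc, hc'⟩ := Finset.exists_mem_eq_inf (running d.config)
      ⟨_, arrival_mem_running _⟩ (fun c => d.clocks c 0)
    change d.wait = _ at hc'
    unfold Data.ringing
    split_ifs with h1 h2 h3
    · exact h1
    · exact h2.2
    · exact h3.2
    · cases c with
      | arrival => exact absurd hc'.symm h1
      | common => exact absurd ⟨hc, hc'.symm⟩ h2
      | single i =>
        fin_cases i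
        · exact absurd ⟨hc, hc'.symm⟩ h3
        · exact hc'.symm
  exact absurd (hr.trans hw) (h _ d.ringing_mem hne).ne'

end Evolution

/-! ### The law of the data with fresh clocks -/

section Law

variable (ρ : Clock → Measure ℝ≥0∞) [∀ c, IsProbabilityMeasure (ρ c)]
  (χ : Measure (Fin 2)) [IsProbabilityMeasure χ]

/-- The law of the fresh clocks. -/
noncomputable def clockLaw : Measure (Clock → ℕ → ℝ≥0∞) := Measure.pi fun c => iidStream (ρ c)

instance : IsProbabilityMeasure (clockLaw ρ) := by unfold clockLaw; infer_instance

theorem measurable_mk (c : Config) :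
    Measurable fun w : (Clock → ℕ → ℝ≥0∞) × (ℕ → Fin 2) => Data.mk c w.1 w.2 :=
  measurable_data_iff.2 ⟨measurable_const,
    fun c k => (measurable_pi_apply k).comp ((measurable_pi_apply c).comp measurable_fst),
    fun k => (measurable_pi_apply k).comp measurable_snd⟩

/-- The law of the data with configuration `c`, fresh clocks and fresh choices. -/
noncomputable def law (c : Config) : Measure Data :=
  ((clockLaw ρ).prod (iidStream χ)).map fun w => Data.mk c w.1 w.2

instance (c : Config) : IsProbabilityMeasure (law ρ χ c) :=
  Measure.isProbabilityMeasure_map (measurable_mk c).aemeasurable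

variable {ρ χ}

theorem law_apply (c : Config) {A : Set Data} (hA : MeasurableSet A) :
    law ρ χ c A = (clockLaw ρ).prod (iidStream χ) {w | Data.mk c w.1 w.2 ∈ A} :=
  Measure.map_apply (measurable_mk c) hA

theorem law_ae_config (c : Config) : ∀ᵐ d ∂law ρ χ c, d.config = c := by
  refine (ae_map_iff (measurable_mk c).aemeasurable (measurableSet_config (· = c))).2 ?_
  exact Eventually.of_forall fun _ => rfl

theorem law_number_inter (c : Config) (j : ℕ) (B : Set Data) :
    law ρ χ c ({d | d.config.number = j} ∩ B) = if c.number = j then law ρ χ c B else 0 := by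
  split_ifs with hj
  · refine measure_congr ?_
    filter_upwards [law_ae_config (ρ := ρ) (χ := χ) c] with d hd
    refine propext (and_iff_right ?_)
    change d.config.number = j
    rw [hd, hj]
  · refine measure_mono_null (fun d hd => ?_) (ae_iff.1 (law_ae_config (ρ := ρ) (χ := χ) c))
    intro hd'
    have h2 : d.config.number = j := hd.1
    rw [hd'] at h2
    exact hj h2

/-- The event that the clocks running in the configuration `c` ring after time `t`. -/
def clocksAbove (c : Config) (t : ℝ≥0∞) : Set (Clock → ℕ → ℝ≥0∞) :=
  {x | ∀ k ∈ running c, t < x k 0}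

/-- The clocks after time `t`, if none rings. -/
noncomputable def ageClocks (c : Config) (t : ℝ≥0∞) (x : Clock → ℕ → ℝ≥0∞) :
    Clock → ℕ → ℝ≥0∞ :=
  fun k => if k ∈ running c then ageStream t (x k) else x k

theorem measurable_head (k : Clock) : Measurable fun x : Clock → ℕ → ℝ≥0∞ => x k 0 :=
  (measurable_pi_apply 0).comp (measurable_pi_apply k)

theorem measurableSet_clocksAbove (c : Config) (t : ℝ≥0∞) : MeasurableSet (clocksAbove c t) := by
  have : clocksAbove c t = ⋂ k ∈ running c, {x | t < x k 0} := by
    ext; simp [clocksAbove]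
  rw [this]
  exact Finset.measurableSet_biInter _ fun k _ =>
    measurableSet_lt measurable_const (measurable_head k)

theorem measurable_ageClocks (c : Config) (t : ℝ≥0∞) : Measurable (ageClocks c t) := by
  refine measurable_pi_lambda _ fun k => ?_
  unfold ageClocks
  split_ifs
  · exact measurable_ageStream.comp (measurable_const.prodMk (measurable_pi_apply k))
  · exact measurable_pi_apply k

theorem clockLaw_clocksAbove (c : Config) (t : ℝ≥0∞) :
    clockLaw ρ (clocksAbove c t) = ∏ k, if k ∈ running c then ρ k (Set.Ioi t) else 1 := by
  have : clocksAbove c t = Set.univ.pi fun k : Clock =>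
      if k ∈ running c then {y : ℕ → ℝ≥0∞ | y 0 ∈ Set.Ioi t} else Set.univ := by
    ext x
    simp only [clocksAbove, Set.mem_ofPred_eq, Set.mem_pi, Set.mem_univ, true_implies]
    refine forall_congr' fun k => ?_
    by_cases hk : k ∈ running c <;> simp [hk]
  rw [this, clockLaw, Measure.pi_pi]
  refine Finset.prod_congr rfl fun k _ => ?_
  by_cases hk : k ∈ running c
  · rw [if_pos hk, if_pos hk]
    exact (measurePreserving_head (ρ k)).measure_preimage measurableSet_Ioi.nullMeasurableSet
  · rw [if_neg hk, if_neg hk, measure_univ]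

/-- On boxes the claim factors over the clocks: running ones contribute the one-dimensional lack of
memory, idle ones are untouched. -/
theorem clockLaw_age (hρ : ∀ k, Memoryless (ρ k)) (c : Config) (t : ℝ≥0∞) :
    ((clockLaw ρ).restrict (clocksAbove c t)).map (ageClocks c t) =
      clockLaw ρ (clocksAbove c t) • clockLaw ρ := by
  refine eq_smul_pi _ fun s hs => ?_
  have hpi : MeasurableSet (Set.univ.pi s) := .pi Set.countable_univ fun k _ => hs k
  rw [Measure.map_apply (measurable_ageClocks c t) hpi,
    Measure.restrict_apply (measurable_ageClocks c t hpi), clockLaw_clocksAbove,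
    ← Finset.prod_mul_distrib]
  have : ageClocks c t ⁻¹' Set.univ.pi s ∩ clocksAbove c t = Set.univ.pi fun k : Clock =>
      if k ∈ running c then {y : ℕ → ℝ≥0∞ | t < y 0 ∧ ageStream t y ∈ s k} else s k := by
    ext x
    simp only [clocksAbove, Set.mem_inter_iff, Set.mem_preimage, Set.mem_ofPred_eq, Set.mem_pi,
      Set.mem_univ, true_implies, ← forall_and]
    refine forall_congr' fun k => ?_
    by_cases hk : k ∈ running c <;> simp [hk, ageClocks, and_comm]
  rw [this, clockLaw, Measure.pi_pi]
  refine Finset.prod_congr rfl fun k _ => ?_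
  by_cases hk : k ∈ running c
  · rw [if_pos hk, if_pos hk, (hρ k).iidStream_age t (hs k)]
  · rw [if_neg hk, if_neg hk, one_mul]

theorem lt_wait_mk_iff {c : Config} {x : Clock → ℕ → ℝ≥0∞} {R : ℕ → Fin 2} {t : ℝ≥0∞} :
    t < (Data.mk c x R).wait ↔ x ∈ clocksAbove c t := Data.lt_wait_iff

theorem measurableSet_lt_wait (t : ℝ≥0∞) : MeasurableSet {d : Data | t < d.wait} :=
  measurableSet_lt measurable_const measurable_wait

theorem law_lt_wait (c : Config) (t : ℝ≥0∞) :
    law ρ χ c {d | t < d.wait} = ∏ k ∈ running c, ρ k (Set.Ioi t) := by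
  rw [law_apply c (measurableSet_lt_wait t)]
  have : {w : (Clock → ℕ → ℝ≥0∞) × (ℕ → Fin 2) | Data.mk c w.1 w.2 ∈ {d | t < d.wait}} =
      clocksAbove c t ×ˢ Set.univ := by
    ext w; simp [lt_wait_mk_iff]
  rw [this, Measure.prod_prod, measure_univ, mul_one, clockLaw_clocksAbove, Finset.prod_ite_mem,
    Finset.univ_inter]

/-- The running clocks have no memory. -/
theorem law_age (hρ : ∀ k, Memoryless (ρ k)) (c : Config) (t : ℝ≥0∞) {A : Set Data}
    (hA : MeasurableSet A) :
    law ρ χ c {d | t < d.wait ∧ d.age t ∈ A} = law ρ χ c {d | t < d.wait} * law ρ χ c A := by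
  have hage : Measurable (Data.age t) := measurable_age.comp (measurable_const.prodMk measurable_id)
  have hm : MeasurableSet {d : Data | t < d.wait ∧ d.age t ∈ A} :=
    (measurableSet_lt_wait t).inter (hage hA)
  rw [law_apply c hm, law_apply c hA, law_apply c (measurableSet_lt_wait t)]
  have h1 := Measure.prod_restrict_map_fst (μ := clockLaw ρ) (ν := iidStream χ)
    (measurableSet_clocksAbove c t) (measurable_ageClocks c t) (measurable_mk c hA)
  rw [clockLaw_age hρ, Measure.prod_smul_left, Measure.smul_apply, smul_eq_mul] at h1
  have h2 : (clockLaw ρ).prod (iidStream χ) {w | Data.mk c w.1 w.2 ∈ {d | t < d.wait}} =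
      clockLaw ρ (clocksAbove c t) := by
    have : {w : (Clock → ℕ → ℝ≥0∞) × (ℕ → Fin 2) | Data.mk c w.1 w.2 ∈ {d | t < d.wait}} =
        clocksAbove c t ×ˢ Set.univ := by
      ext w; simp [lt_wait_mk_iff]
    rw [this, Measure.prod_prod, measure_univ, mul_one]
  rw [h2]
  refine Eq.trans ?_ h1
  congr 1
  ext w
  exact and_congr lt_wait_mk_iff Iff.rfl

/-- The waiting time for the first event is independent of the data after the event. -/
theorem law_wait_step (hρ : ∀ k, Memoryless (ρ k)) (c : Config) (t : ℝ≥0∞) {A : Set Data}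
    (hA : MeasurableSet A) :
    law ρ χ c {d | t < d.wait ∧ d.step ∈ A} =
      law ρ χ c {d | t < d.wait} * law ρ χ c (Data.step ⁻¹' A) := by
  -- Before the first event, `step` of the data equals `step` of the aged data, and the aged data
  -- are fresh.
  rw [← law_age hρ c t (measurable_step hA)]
  congr 1
  ext d
  refine and_congr_right fun h => ?_
  rw [Set.mem_preimage, Data.step_age h]

/-! ### The first event -/

/-- The event that `k` is the first of the clocks running in the configuration `c` to ring. -/
def firstRings (c : Config) (k : Clock) : Set (Clock → ℕ → ℝ≥0∞) :=
  {x | ∀ k' ∈ running c, k' ≠ k → x k 0 < x k' 0}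

/-- The clocks after the first event, if the clock `k` rings first. -/
noncomputable def stepClocks (c : Config) (k : Clock) (x : Clock → ℕ → ℝ≥0∞) :
    Clock → ℕ → ℝ≥0∞ :=
  fun k' => if k' ∈ discarded c k then streamTail (x k')
    else if k' ∈ running c then ageStream (x k 0) (x k') else x k'

theorem measurableSet_firstRings (c : Config) (k : Clock) : MeasurableSet (firstRings c k) := by
  have : firstRings c k = ⋂ k' ∈ (running c).erase k, {x | x k 0 < x k' 0} := by
    ext x
    simp only [firstRings, Set.mem_ofPred_eq, Finset.mem_erase, Set.mem_iInter]
    exact ⟨fun h k' hk' => h k' hk'.2 hk'.1, fun h k' h1 h2 => h k' ⟨h2, h1⟩⟩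
  rw [this]
  exact Finset.measurableSet_biInter _ fun k' _ =>
    measurableSet_lt (measurable_head k) (measurable_head k')

theorem measurable_stepClocks (c : Config) (k : Clock) : Measurable (stepClocks c k) := by
  refine measurable_pi_lambda _ fun k' => ?_
  unfold stepClocks
  split_ifs
  · exact measurable_streamTail.comp (measurable_pi_apply k')
  · exact measurable_ageStream.comp ((measurable_head k).prodMk (measurable_pi_apply k'))
  · exact measurable_pi_apply k'

theorem step_mk {c : Config} {k : Clock} (hk : k ∈ running c) {x : Clock → ℕ → ℝ≥0∞}
    (hx : x ∈ firstRings c k) (R : ℕ → Fin 2) :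
    (Data.mk c x R).step = ⟨next (R 0) c k, stepClocks c k x, streamTail R⟩ := by
  obtain ⟨h1, h2⟩ := Data.ringing_eq_of_lt (d := Data.mk c x R) hk hx
  unfold Data.step
  rw [h1, h2]
  congr 1
  funext k' n
  simp only [stepClocks]
  split_ifs with h3 h4 h5 h6
  · rfl
  · simp [ageStream, h4.2]
  · exact absurd h4.1 h5
  · have : n ≠ 0 := fun hn => h4 ⟨h6, hn⟩
    simp [ageStream, this]
  · rfl

/-- The clock that has rung must be replaced: its residual `0` would not be fresh. -/
theorem self_mem_discarded {c : Config} {k : Clock} (hk : k ∈ running c) : k ∈ discarded c k := by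
  match c, k with
  | _, .arrival => simp [discarded]
  | .empty, .single _ => simp [running] at hk
  | .empty, .common => simp [running] at hk
  | .one _, .single _ => simpa [discarded, running] using hk
  | .one _, .common => simp [discarded]
  | .both _, .single _ => simp [discarded]
  | .both _, .common => simp [discarded]

/-- Consequently the stream of an idle clock is left alone by an event. -/
theorem discarded_subset_running {c : Config} {k : Clock} (hk : k ∈ running c) :
    discarded c k ⊆ running c := by
  match c, k with
  | _, .arrival => simpa [discarded] using hk
  | .empty, .single _ => simp [running] at hk
  | .empty, .common => simp [running] at hk
  | .one _, .single _ => simp [discarded, running]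
  | .one _, .common => simp [discarded, running]
  | .both _, .single _ => simpa [discarded] using hk
  | .both _, .common => simp [discarded, running]

variable (ρ) in
/-- The probability that the clock `k` is the first to ring in the configuration `c`. -/
noncomputable def ringProb (c : Config) (k : Clock) : ℝ≥0∞ :=
  ∫⁻ s, ∏ k' ∈ (running c).erase k, ρ k' (Set.Ioi s) ∂ρ k

theorem measurable_survival (μ : Measure ℝ≥0∞) : Measurable fun s => μ (Set.Ioi s) :=
  Antitone.measurable fun _ _ h => measure_mono (Set.Ioi_subset_Ioi h)

/-- This is the lack of memory at the random time of the first event. By Fubini the value of `k` may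
be held fixed; every other running clock must exceed it, and then is either aged, hence fresh, or
discarded, its tail being independent of its head. The clock `k` itself passes to its independent
tail. -/
theorem clockLaw_step (hρ : ∀ k, Memoryless (ρ k)) {c : Config} {k : Clock} (hk : k ∈ running c) :
    ((clockLaw ρ).restrict (firstRings c k)).map (stepClocks c k) =
      ringProb ρ c k • clockLaw ρ := by
  refine eq_smul_pi _ fun s hs => ?_
  have hpi : MeasurableSet (Set.univ.pi s) := .pi Set.countable_univ fun k _ => hs k
  rw [Measure.map_apply (measurable_stepClocks c k) hpi,
    Measure.restrict_apply (measurable_stepClocks c k hpi)]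
  -- For a given stream `y` of the clock `k`, the conditions on the other clocks decouple into one
  -- set per clock, as `pi_sections` requires.
  set U : Clock → (ℕ → ℝ≥0∞) → Set (ℕ → ℝ≥0∞) := fun k' y =>
    {z | (k' ∈ running c → y 0 < z 0) ∧
      (if k' ∈ discarded c k then streamTail z
        else if k' ∈ running c then ageStream (y 0) z else z) ∈ s k'} with hU
  have hUm : ∀ k', MeasurableSet {z : (ℕ → ℝ≥0∞) × (ℕ → ℝ≥0∞) | z.2 ∈ U k' z.1} := fun k' => by
    have h0 : Measurable fun x : ℕ → ℝ≥0∞ => x 0 := measurable_pi_apply 0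
    refine MeasurableSet.inter ?_ ?_
    · by_cases h : k' ∈ running c
      · simp only [h, true_implies]
        exact measurableSet_lt (h0.comp measurable_fst) (h0.comp measurable_snd)
      · simp only [h, false_implies]
        exact MeasurableSet.univ
    · split_ifs
      · exact (measurable_streamTail.comp measurable_snd) (hs k')
      · exact (measurable_ageStream.comp ((h0.comp measurable_fst).prodMk measurable_snd)) (hs k')
      · exact measurable_snd (hs k')
  have hset : stepClocks c k ⁻¹' Set.univ.pi s ∩ firstRings c k =
      {x | x k ∈ streamTail ⁻¹' s k ∧ ∀ k', k' ≠ k → x k' ∈ U k' (x k)} := by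
    ext x
    simp only [Set.mem_inter_iff, Set.mem_preimage, Set.mem_pi, Set.mem_univ, true_implies,
      firstRings, stepClocks, Set.mem_ofPred_eq, hU]
    constructor
    · rintro ⟨h1, h2⟩
      refine ⟨?_, fun k' hk' => ⟨fun h => h2 k' h hk', h1 k'⟩⟩
      have := h1 k
      rwa [if_pos (self_mem_discarded hk)] at this
    · rintro ⟨h1, h2⟩
      refine ⟨fun k' => ?_, fun k' h hk' => (h2 k' hk').1 h⟩
      by_cases hk' : k' = k
      · subst hk'
        rwa [if_pos (self_mem_discarded hk)]
      · exact (h2 k' hk').2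
  have hUval : ∀ k' y, iidStream (ρ k') (U k' y) =
      (if k' ∈ running c then ρ k' (Set.Ioi (y 0)) else 1) * iidStream (ρ k') (s k') := by
    intro k' y
    by_cases h1 : k' ∈ running c
    · by_cases h2 : k' ∈ discarded c k
      · simp only [hU, h1, h2, if_true, true_implies]
        exact iidStream_head_inter_tail (ρ k') measurableSet_Ioi (hs k')
      · simp only [hU, h1, h2, if_true, if_false, true_implies]
        exact (hρ k').iidStream_age (y 0) (hs k')
    · have h2 : k' ∉ discarded c k := fun h => h1 (discarded_subset_running hk h)
      simp [hU, h1, h2]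
  rw [hset, clockLaw]
  refine (pi_sections (fun c => iidStream (ρ c)) k (measurable_streamTail (hs k)) U hUm).trans ?_
  simp only [hUval, Finset.prod_mul_distrib]
  have hm : Measurable fun t => ∏ k' ∈ (running c).erase k, ρ k' (Set.Ioi t) :=
    Finset.measurable_prod _ fun k' _ => measurable_survival (ρ k')
  have hprod : ∀ t, (∏ k' ∈ Finset.univ.erase k, if k' ∈ running c then ρ k' (Set.Ioi t) else 1) =
      ∏ k' ∈ (running c).erase k, ρ k' (Set.Ioi t) := fun t => by
    rw [Finset.prod_ite_mem]
    congr 1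
    ext; simp
  simp only [hprod]
  have hm0 : Measurable fun y : ℕ → ℝ≥0∞ => ∏ k' ∈ (running c).erase k, ρ k' (Set.Ioi (y 0)) :=
    hm.comp (measurable_pi_apply 0)
  rw [lintegral_mul_const _ hm0]
  -- The integrand involves only the head of the stream of `k` and the constraint only its tail, so
  -- the integral factors.
  have hint : ∫⁻ y in streamTail ⁻¹' s k, ∏ k' ∈ (running c).erase k, ρ k' (Set.Ioi (y 0))
      ∂iidStream (ρ k) = ringProb ρ c k * iidStream (ρ k) (s k) := by
    have hmp := measurePreserving_head_tail (ρ k)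
    have h1 := hmp.setLIntegral_comp_preimage (MeasurableSet.univ.prod (hs k))
      (hm.comp measurable_fst)
    rw [← Measure.prod_restrict, Measure.restrict_univ, lintegral_prod _
      (hm.comp measurable_fst).aemeasurable] at h1
    simp only [Function.comp, lintegral_const, Measure.restrict_apply_univ] at h1
    rw [lintegral_mul_const _ hm] at h1
    rw [ringProb, ← h1]
    congr 2
    ext; simp
  rw [hint, mul_assoc, Finset.mul_prod_erase _ (fun i => iidStream (ρ i) (s i)) (Finset.mem_univ k)]

/-- One choice is consumed at every event, whether or not it is used; the remaining choices stay
independent and fresh. -/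
theorem law_first_step (hρ : ∀ k, Memoryless (ρ k)) {c : Config} {k : Clock} (hk : k ∈ running c)
    {A : Set Data} (hA : MeasurableSet A) :
    law ρ χ c {d | d.clocks ∈ firstRings c k ∧ d.step ∈ A} =
      ringProb ρ c k * ∫⁻ b, law ρ χ (next b c k) A ∂χ := by
  have hm : Measurable fun w : (Clock → ℕ → ℝ≥0∞) × (ℕ → Fin 2) =>
      Data.mk (next (w.2 0) c k) w.1 (streamTail w.2) := by
    refine measurable_data_iff.2 ⟨?_, fun c k => ?_, fun k => ?_⟩
    · exact (measurable_of_countable fun b => next b c k).comp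
        ((measurable_pi_apply 0).comp measurable_snd)
    · exact (measurable_pi_apply k).comp ((measurable_pi_apply c).comp measurable_fst)
    · exact (measurable_pi_apply (k + 1)).comp measurable_snd
  have hm' : MeasurableSet {d : Data | d.clocks ∈ firstRings c k ∧ d.step ∈ A} :=
    (measurable_clocks (measurableSet_firstRings c k)).inter (measurable_step hA)
  rw [law_apply c hm']
  have h1 := Measure.prod_restrict_map_fst (μ := clockLaw ρ) (ν := iidStream χ)
    (measurableSet_firstRings c k) (measurable_stepClocks c k) (hm hA)
  rw [clockLaw_step hρ hk, Measure.prod_smul_left, Measure.smul_apply, smul_eq_mul] at h1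
  have h2 : (clockLaw ρ).prod (iidStream χ) {w | Data.mk c w.1 w.2 ∈
      {d | d.clocks ∈ firstRings c k ∧ d.step ∈ A}} =
      (clockLaw ρ).prod (iidStream χ) {w | w.1 ∈ firstRings c k ∧
        (stepClocks c k w.1, w.2) ∈ (fun w : (Clock → ℕ → ℝ≥0∞) × (ℕ → Fin 2) =>
          Data.mk (next (w.2 0) c k) w.1 (streamTail w.2)) ⁻¹' A} := by
    congr 1
    ext w
    refine and_congr_right fun h => ?_
    rw [Set.mem_preimage, ← step_mk hk h]
  -- The choices become the outer variable, so that their head can be separated as the server `b`.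
  rw [h2, h1, Measure.prod_apply_symm (hm hA)]
  congr 1
  have hmp := measurePreserving_head_tail χ
  have hf : Measurable fun z : Fin 2 × (ℕ → Fin 2) =>
      clockLaw ρ {x | Data.mk (next z.1 c k) x z.2 ∈ A} := by
    have : Measurable fun w : (Fin 2 × (ℕ → Fin 2)) × (Clock → ℕ → ℝ≥0∞) =>
        Data.mk (next w.1.1 c k) w.2 w.1.2 := by
      refine measurable_data_iff.2 ⟨?_, fun c k => ?_, fun k => ?_⟩
      · exact (measurable_of_countable fun b => next b c k).comp
          (measurable_fst.comp measurable_fst)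
      · exact (measurable_pi_apply k).comp ((measurable_pi_apply c).comp measurable_snd)
      · exact (measurable_pi_apply k).comp (measurable_snd.comp measurable_fst)
    exact measurable_measure_prodMk_left (this hA)
  refine (hmp.lintegral_comp hf).trans ?_
  rw [lintegral_prod _ hf.aemeasurable]
  refine lintegral_congr fun b => ?_
  rw [law_apply _ hA, ← Set.preimage, Measure.prod_apply_symm (measurable_mk _ hA)]
  rfl

/-- The probability that a given clock rings first. -/
theorem ringProb_eq {r : Clock → ℝ} (hr : ∀ k, 0 ≤ r k) (hr0 : 0 < r .arrival)
    (hρ : ∀ k, HasExpLaw (r k) (ρ k)) {c : Config} {k : Clock} (hk : k ∈ running c) :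
    ringProb ρ c k = ENNReal.ofReal (r k / ∑ k' ∈ running c, r k') := by
  have hsum := Finset.add_sum_erase _ r hk
  have hpos : 0 < ∑ k' ∈ running c, r k' :=
    hr0.trans_le (Finset.single_le_sum (fun k _ => hr k) (arrival_mem_running c))
  rw [← hsum, ringProb]
  refine (hρ k).lintegral_survival (hr k) (Finset.sum_nonneg fun k _ => hr k) (by rwa [hsum])
    (Finset.measurable_prod _ fun k' _ => measurable_survival (ρ k')) (fun t ht => ?_)
    fun hk0 => ?_
  · rw [Finset.prod_congr rfl fun k' _ => hρ k' t ht,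
      ← ENNReal.ofReal_prod_of_nonneg fun _ _ => Real.exp_nonneg _, ← Real.exp_sum,
      Finset.sum_neg_distrib, Finset.sum_mul]
  -- A clock of rate `0` is not the arrival clock, which is then among the competitors and has no
  -- mass beyond `⊤`.
  · refine Finset.prod_eq_zero (i := .arrival) ?_ (by simp)
    refine Finset.mem_erase.2 ⟨?_, arrival_mem_running c⟩
    rintro rfl
    exact hr0.ne' hk0

/-- The law of the data after the first event. -/
theorem law_step {r : Clock → ℝ} (hr : ∀ k, 0 ≤ r k) (hr0 : 0 < r .arrival)
    (hρ : ∀ k, HasExpLaw (r k) (ρ k)) (c : Config) {A : Set Data} (hA : MeasurableSet A) :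
    law ρ χ c (Data.step ⁻¹' A) = ∑ k ∈ running c,
      ENNReal.ofReal (r k / ∑ k' ∈ running c, r k') * ∫⁻ b, law ρ χ (next b c k) A ∂χ := by
  have hmem : ∀ k, Memoryless (ρ k) := fun k => (hρ k).memoryless
  have hpos : 0 < ∑ k' ∈ running c, r k' :=
    hr0.trans_le (Finset.single_le_sum (fun k _ => hr k) (arrival_mem_running c))
  have hS : ∀ k, MeasurableSet (Data.clocks ⁻¹' firstRings c k) := fun k =>
    measurable_clocks (measurableSet_firstRings c k)
  have hdisj : (running c : Set Clock).PairwiseDisjoint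
      fun k => Data.clocks ⁻¹' firstRings c k := by
    intro k hk k' hk' hne
    refine Set.disjoint_left.2 fun d hd hd' => ?_
    exact lt_asymm (hd k' hk' hne.symm) (hd' k hk hne)
  have hsum : ∀ B : Set Data, MeasurableSet B →
      law ρ χ c (Data.step ⁻¹' B ∩ ⋃ k ∈ running c, Data.clocks ⁻¹' firstRings c k) =
      ∑ k ∈ running c, ENNReal.ofReal (r k / ∑ k' ∈ running c, r k') *
        ∫⁻ b, law ρ χ (next b c k) B ∂χ := fun B hB => by
    rw [Set.inter_iUnion₂, measure_biUnion_finset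
      (hdisj.mono fun k => Set.inter_subset_right)
      fun k _ => (measurable_step hB).inter (hS k)]
    refine Finset.sum_congr rfl fun k hk => ?_
    rw [← ringProb_eq hr hr0 hρ hk, ← law_first_step hmem hk hB, Set.inter_comm]
    rfl
  -- The probabilities of ringing strictly first already add up to one, so ties are null.
  have hfull : law ρ χ c (⋃ k ∈ running c, Data.clocks ⁻¹' firstRings c k) = 1 := by
    have := hsum Set.univ MeasurableSet.univ
    simp only [Set.preimage_univ, Set.univ_inter, measure_univ, lintegral_const, mul_one] at this
    rw [this, ← ENNReal.ofReal_sum_of_nonneg fun k _ => div_nonneg (hr k) hpos.le,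
      ← Finset.sum_div, div_self hpos.ne', ENNReal.ofReal_one]
  rw [← hsum A hA]
  refine (measure_inter_conull ?_).symm
  exact (prob_compl_eq_zero_iff (Finset.measurableSet_biUnion _ fun k _ => hS k)).2 hfull

/-- The waiting time for the first event. -/
theorem law_lt_wait_exp {r : Clock → ℝ} (hρ : ∀ k, HasExpLaw (r k) (ρ k)) (c : Config) {t : ℝ}
    (ht : 0 ≤ t) : law ρ χ c {d | ENNReal.ofReal t < d.wait} =
      ENNReal.ofReal (Real.exp (-((∑ k ∈ running c, r k) * t))) := by
  rw [law_lt_wait, Finset.prod_congr rfl fun k' _ => hρ k' t ht,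
    ← ENNReal.ofReal_prod_of_nonneg fun _ _ => Real.exp_nonneg _, ← Real.exp_sum,
    Finset.sum_neg_distrib, Finset.sum_mul]

end Law

/-! ### Lumping for homogeneous servers -/

section Lumping

/-- The parameters of the exponential sojourn times. -/
def sojournRate (lam mu mu12 : ℝ) : ℕ → ℝ
  | 0 => lam
  | 1 => lam + mu + mu12
  | _ + 2 => lam + 2 * mu + mu12

/-- The transition probabilities of the embedded chain. -/
noncomputable def jumpProb (lam mu mu12 : ℝ) (i j : ℕ) : ℝ :=
  if i = j then 0 else Q0 lam mu mu12 i j / sojournRate lam mu mu12 i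

/-- The mean of `g` after a jump of the embedded chain from `i`. -/
noncomputable def jumpMean (lam mu mu12 : ℝ) (g : ℕ → ℝ≥0∞) (i : ℕ) : ℝ≥0∞ :=
  ∑ j ∈ Finset.range (i + 2), ENNReal.ofReal (jumpProb lam mu mu12 i j) * g j

/-- The clocks of an `M/M_D/2` queue with homogeneous servers. -/
structure IsHomogeneous (lam mu mu12 : ℝ) (ρ : Clock → Measure ℝ≥0∞) : Prop where
  lam_pos : 0 < lam
  mu_nonneg : 0 ≤ mu
  mu12_nonneg : 0 ≤ mu12
  hasExpLaw : ∀ k, HasExpLaw (rate lam mu mu mu12 k) (ρ k)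

variable {lam mu mu12 : ℝ} {ρ : Clock → Measure ℝ≥0∞}

/-- Homogeneity enters here: the total rate with one customer is the same at either server. -/
theorem sum_rate (c : Config) :
    ∑ k ∈ running c, rate lam mu mu mu12 k = sojournRate lam mu mu12 c.number := by
  cases c with
  | empty => simp [running, rate, sojournRate, Config.number]
  | one i => simp [running, rate, sojournRate, Config.number]; ring
  | both q => simp [running, rate, sojournRate, Config.number]; ring

namespace IsHomogeneous

theorem rate_nonneg (h : IsHomogeneous lam mu mu12 ρ) (k : Clock) : 0 ≤ rate lam mu mu mu12 k := by
  cases k with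
  | arrival => exact h.lam_pos.le
  | single i => simpa [rate] using h.mu_nonneg
  | common => exact h.mu12_nonneg

theorem sojournRate_pos (h : IsHomogeneous lam mu mu12 ρ) (i : ℕ) :
    0 < sojournRate lam mu mu12 i := by
  have := h.lam_pos; have := h.mu_nonneg; have := h.mu12_nonneg
  match i with
  | 0 => exact h.lam_pos
  | 1 => unfold sojournRate; positivity
  | i + 2 => unfold sojournRate; positivity

/-- The uniform bound serves both non-explosion and the remainder in the derivative at time `0`. -/
theorem sojournRate_le (h : IsHomogeneous lam mu mu12 ρ) (i : ℕ) :
    sojournRate lam mu mu12 i ≤ lam + 2 * mu + mu12 := by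
  have := h.lam_pos; have := h.mu_nonneg; have := h.mu12_nonneg
  match i with
  | 0 => unfold sojournRate; linarith
  | 1 => unfold sojournRate; linarith
  | i + 2 => exact le_rfl

theorem jumpProb_nonneg (h : IsHomogeneous lam mu mu12 ρ) (i j : ℕ) :
    0 ≤ jumpProb lam mu mu12 i j := by
  have h1 := h.lam_pos.le; have h2 := h.mu_nonneg; have h3 := h.mu12_nonneg
  unfold jumpProb
  split_ifs with hij
  · exact le_rfl
  · refine div_nonneg ?_ (h.sojournRate_pos i).le
    match i with
    | 0 => simp only [Q0]; split_ifs <;> first | positivity | omega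
    | 1 => simp only [Q0]; split_ifs <;> first | positivity | omega
    | i + 2 => simp only [Q0]; split_ifs <;> first | positivity | omega

end IsHomogeneous

theorem Q0_diag (i : ℕ) : Q0 lam mu mu12 i i = -sojournRate lam mu mu12 i := by
  match i with
  | 0 => simp [Q0, sojournRate]
  | 1 => simp [Q0, sojournRate]
  | i + 2 => simp [Q0, sojournRate]

theorem IsHomogeneous.Q0_off_diag (h : IsHomogeneous lam mu mu12 ρ) {i j : ℕ} (hij : i ≠ j) :
    Q0 lam mu mu12 i j = sojournRate lam mu mu12 i * jumpProb lam mu mu12 i j := by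
  rw [jumpProb, if_neg hij, mul_div_cancel₀ _ (h.sojournRate_pos i).ne']

/-- Upward jumps have size one, so the finite range in `jumpMean` misses no possible target. -/
theorem jumpProb_eq_zero {i j : ℕ} (hij : i + 2 ≤ j) : jumpProb lam mu mu12 i j = 0 := by
  unfold jumpProb
  rw [if_neg (by omega)]
  match i with
  | 0 => simp only [Q0]; rw [if_neg (by omega), if_neg (by omega), zero_div]
  | 1 => simp only [Q0]; rw [if_neg (by omega), if_neg (by omega), if_neg (by omega), zero_div]
  | i + 2 =>
    simp only [Q0]
    rw [if_neg (by omega), if_neg (by omega), if_neg (by omega), if_neg (by omega), zero_div]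

theorem jumpMean_zero (hlam : lam ≠ 0) (g : ℕ → ℝ≥0∞) : jumpMean lam mu mu12 g 0 = g 1 := by
  simp [jumpMean, Finset.sum_range_succ, jumpProb, Q0, sojournRate, hlam]

theorem jumpMean_one (g : ℕ → ℝ≥0∞) : jumpMean lam mu mu12 g 1 =
    ENNReal.ofReal ((mu + mu12) / (lam + mu + mu12)) * g 0 +
      ENNReal.ofReal (lam / (lam + mu + mu12)) * g 2 := by
  simp [jumpMean, Finset.sum_range_succ, jumpProb, Q0, sojournRate]

theorem jumpMean_add_two (g : ℕ → ℝ≥0∞) (i : ℕ) : jumpMean lam mu mu12 g (i + 2) =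
    ENNReal.ofReal (mu12 / (lam + 2 * mu + mu12)) * g i +
      ENNReal.ofReal (2 * mu / (lam + 2 * mu + mu12)) * g (i + 1) +
      ENNReal.ofReal (lam / (lam + 2 * mu + mu12)) * g (i + 3) := by
  have h0 : ∑ j ∈ Finset.range i,
      ENNReal.ofReal (jumpProb lam mu mu12 (i + 2) j) * g j = 0 := by
    refine Finset.sum_eq_zero fun j hj => ?_
    have hj := Finset.mem_range.1 hj
    unfold jumpProb
    simp only [Q0]
    rw [if_neg (by omega), if_neg (by omega), if_neg (by omega), if_neg (by omega),
      if_neg (by omega)]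
    simp
  rw [jumpMean, Finset.sum_range_succ, Finset.sum_range_succ, Finset.sum_range_succ,
    Finset.sum_range_succ, h0]
  simp [jumpProb, Q0, sojournRate]

theorem jumpMean_mul_const (g : ℕ → ℝ≥0∞) (a : ℝ≥0∞) (i : ℕ) :
    jumpMean lam mu mu12 (fun j => g j * a) i = jumpMean lam mu mu12 g i * a := by
  simp only [jumpMean, Finset.sum_mul, mul_assoc]

theorem jumpMean_single (a : ℝ≥0∞) (i j : ℕ) :
    jumpMean lam mu mu12 (fun l => if l = j then a else 0) i =
      ENNReal.ofReal (jumpProb lam mu mu12 i j) * a := by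
  simp only [jumpMean, mul_ite, mul_zero, Finset.sum_ite_eq']
  split_ifs with h
  · rfl
  · rw [jumpProb_eq_zero (by simpa using h)]
    simp

theorem IsHomogeneous.hasSum_jumpProb (h : IsHomogeneous lam mu mu12 ρ) (i : ℕ) :
    HasSum (jumpProb lam mu mu12 i) 1 := by
  have h1 := h.lam_pos; have h2 := h.mu_nonneg; have h3 := h.mu12_nonneg
  have hm : jumpMean lam mu mu12 (fun _ => 1) i = 1 := by
    match i with
    | 0 => exact jumpMean_zero h1.ne' _
    | 1 =>
      rw [jumpMean_one, mul_one, mul_one, ← ENNReal.ofReal_add (by positivity) (by positivity),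
        ← add_div, show mu + mu12 + lam = lam + mu + mu12 by ring, div_self (by positivity),
        ENNReal.ofReal_one]
    | i + 2 =>
      rw [jumpMean_add_two, mul_one, mul_one, mul_one,
        ← ENNReal.ofReal_add (by positivity) (by positivity),
        ← ENNReal.ofReal_add (by positivity) (by positivity),
        ← add_div, ← add_div, show mu12 + 2 * mu + lam = lam + 2 * mu + mu12 by ring,
        div_self (by positivity), ENNReal.ofReal_one]
  simp only [jumpMean, mul_one] at hm
  rw [← ENNReal.ofReal_sum_of_nonneg fun j _ => h.jumpProb_nonneg i j,
    ENNReal.ofReal_eq_one] at hm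
  rw [← hm]
  exact hasSum_sum_of_ne_finset_zero fun j hj =>
    jumpProb_eq_zero (by simpa using hj)

variable [∀ c, IsProbabilityMeasure (ρ c)] {χ : Measure (Fin 2)} [IsProbabilityMeasure χ]

namespace IsHomogeneous

/-- If the probability of an event depends only on the initial number of customers, so does the
probability that it occurs after the first event. -/
theorem law_step_eq_jumpMean (h : IsHomogeneous lam mu mu12 ρ) {A : Set Data}
    (hA : MeasurableSet A) {g : ℕ → ℝ≥0∞} (hg : ∀ c, law ρ χ c A = g c.number) (c : Config) :
    law ρ χ c (Data.step ⁻¹' A) = jumpMean lam mu mu12 g c.number := by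
  have h1 := h.lam_pos; have h2 := h.mu_nonneg; have h3 := h.mu12_nonneg
  rw [law_step h.rate_nonneg h1 h.hasExpLaw c hA, sum_rate]
  -- The integrand now depends on the chosen server only through a number of customers, which is the
  -- same for both choices.
  simp only [hg]
  match c with
  | .empty =>
    rw [show Config.number .empty = 0 from rfl, jumpMean_zero h1.ne']
    simp [running, rate, sojournRate, next, Config.number, h1.ne']
  | .one i =>
    rw [show Config.number (.one i) = 1 from rfl, jumpMean_one]
    simp only [running, Finset.mem_insert, Finset.mem_singleton, reduceCtorEq, or_self,
      not_false_eq_true, Finset.sum_insert, Finset.sum_singleton, rate, next, Config.number,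
      lintegral_const, measure_univ, mul_one, ite_self, sojournRate]
    rw [add_div, ENNReal.ofReal_add (by positivity) (by positivity)]
    ring
  | .both q =>
    rw [show Config.number (.both q) = q + 2 from rfl, jumpMean_add_two]
    -- The two single shocks lead to the same number of customers and contribute `mu` each.
    have h4 : ENNReal.ofReal (2 * mu / (lam + 2 * mu + mu12)) =
        ENNReal.ofReal (mu / (lam + 2 * mu + mu12)) +
          ENNReal.ofReal (mu / (lam + 2 * mu + mu12)) := by
      rw [← ENNReal.ofReal_add (by positivity) (by positivity)]
      congr 1; ring
    rw [h4]
    match q with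
    | 0 =>
      simp [running, rate, next, Config.number, sojournRate]
      ring
    | 1 =>
      simp [running, rate, next, Config.number, sojournRate]
      ring
    | q + 2 =>
      simp [running, rate, next, Config.number, sojournRate]
      ring

/-- A bound which holds for every initial configuration holds after the first event. -/
theorem law_step_le (h : IsHomogeneous lam mu mu12 ρ) {A : Set Data}
    (hA : MeasurableSet A) {a : ℝ≥0∞} (ha : ∀ c, law ρ χ c A ≤ a) (c : Config) :
    law ρ χ c (Data.step ⁻¹' A) ≤ a := by
  have hpos : 0 < ∑ k ∈ running c, rate lam mu mu mu12 k := by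
    rw [sum_rate]; exact h.sojournRate_pos _
  rw [law_step h.rate_nonneg h.lam_pos h.hasExpLaw c hA]
  calc _ ≤ ∑ k ∈ running c, ENNReal.ofReal (rate lam mu mu mu12 k /
        ∑ k' ∈ running c, rate lam mu mu mu12 k') * a := by
        refine Finset.sum_le_sum fun k _ => mul_le_mul_right ?_ _
        refine (lintegral_mono fun b => ha _).trans ?_
        simp
    _ = a := by
        rw [← Finset.sum_mul, ← ENNReal.ofReal_sum_of_nonneg fun k _ =>
          div_nonneg (h.rate_nonneg k) hpos.le, ← Finset.sum_div, div_self hpos.ne',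
          ENNReal.ofReal_one, one_mul]

theorem law_lt_wait (h : IsHomogeneous lam mu mu12 ρ) (c : Config) {t : ℝ} (ht : 0 ≤ t) :
    law ρ χ c {d | ENNReal.ofReal t < d.wait} =
      ENNReal.ofReal (Real.exp (-(sojournRate lam mu mu12 c.number * t))) := by
  rw [law_lt_wait_exp h.hasExpLaw c ht, sum_rate]

theorem memoryless (h : IsHomogeneous lam mu mu12 ρ) (k : Clock) : Memoryless (ρ k) :=
  (h.hasExpLaw k).memoryless

end IsHomogeneous

instance (c : Config) : IsProbabilityMeasure ((law ρ χ c).map Data.wait) :=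
  Measure.isProbabilityMeasure_map measurable_wait.aemeasurable

theorem IsHomogeneous.hasExpLaw_wait (h : IsHomogeneous lam mu mu12 ρ) (c : Config) :
    HasExpLaw (sojournRate lam mu mu12 c.number) ((law ρ χ c).map Data.wait) := fun t ht => by
  rw [Measure.map_apply measurable_wait measurableSet_Ioi]
  exact h.law_lt_wait c ht

/-- It allows a configuration to be exchanged for the representative `configOf` in the decomposition
at the first event. -/
theorem IsHomogeneous.map_wait_eq (h : IsHomogeneous lam mu mu12 ρ) {c c' : Config}
    (hc : c.number = c'.number) : (law ρ χ c).map Data.wait = (law ρ χ c').map Data.wait :=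
  (h.hasExpLaw_wait c).unique (hc ▸ h.hasExpLaw_wait c')

/-- `law_wait_step` gives the product formula for rays `t < wait`. With the set `A` for the data
after the event fixed, both sides are finite measures in the wait, hence agree on all measurable
sets. -/
theorem indepFun_wait_step (hρ : ∀ k, Memoryless (ρ k)) (c : Config) :
    IndepFun Data.wait Data.step (law ρ χ c) := by
  refine indepFun_iff_measure_inter_preimage_eq_mul.2 fun B A hB hA => ?_
  have h1 : ((law ρ χ c).restrict (Data.step ⁻¹' A)).map Data.wait =
      law ρ χ c (Data.step ⁻¹' A) • (law ρ χ c).map Data.wait := by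
    refine ENNReal.measure_ext_of_Ioi_ofReal ?_ fun t _ => ?_
    · rw [Measure.map_apply measurable_wait MeasurableSet.univ]
      simp
    · rw [Measure.map_apply measurable_wait measurableSet_Ioi,
        Measure.restrict_apply (measurable_wait measurableSet_Ioi), Measure.smul_apply,
        Measure.map_apply measurable_wait measurableSet_Ioi, smul_eq_mul, mul_comm]
      exact law_wait_step hρ c _ hA
  have h2 := congrArg (fun μ => μ B) h1
  simpa [Measure.map_apply measurable_wait hB, Measure.restrict_apply (measurable_wait hB),
    mul_comm] using h2

/-- Decomposition at the first event. -/
theorem law_eq_lintegral_wait (hρ : ∀ k, Memoryless (ρ k)) (c : Config) {S : Set (ℝ≥0∞ × Data)}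
    (hS : MeasurableSet S) :
    law ρ χ c {d | (d.wait, d.step) ∈ S} =
      ∫⁻ s, law ρ χ c (Data.step ⁻¹' {d | (s, d) ∈ S}) ∂(law ρ χ c).map Data.wait := by
  have h1 := (indepFun_iff_map_prod_eq_prod_map_map measurable_wait.aemeasurable
    measurable_step.aemeasurable).1 (indepFun_wait_step (χ := χ) hρ c)
  have h2 := Measure.map_apply (μ := law ρ χ c) (measurable_wait.prodMk measurable_step) hS
  have : IsProbabilityMeasure ((law ρ χ c).map Data.step) :=
    Measure.isProbabilityMeasure_map measurable_step.aemeasurable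
  rw [h1, Measure.prod_apply hS] at h2
  refine h2.symm.trans (lintegral_congr fun s => ?_)
  exact Measure.map_apply measurable_step (measurable_prodMk_left hS)

end Lumping

/-! ### Non-explosion -/

section NonExplosion

/-- Only finitely many events occur in bounded time. -/
def Data.NonExplosive (d : Data) : Prop := ∀ N : ℕ, ∃ n, (N : ℝ≥0∞) ≤ d.time n

theorem Data.after_after (d : Data) (m n : ℕ) : (d.after m).after n = d.after (n + m) :=
  (Function.iterate_add_apply _ n m d).symm

variable {lam mu mu12 : ℝ} {ρ : Clock → Measure ℝ≥0∞} [∀ c, IsProbabilityMeasure (ρ c)]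
  {χ : Measure (Fin 2)} [IsProbabilityMeasure χ]

namespace IsHomogeneous

theorem ae_after (h : IsHomogeneous lam mu mu12 ρ) {A : Set Data} (hA : MeasurableSet A)
    (hA' : ∀ c, ∀ᵐ d ∂law ρ χ c, d ∈ A) (n : ℕ) : ∀ c, ∀ᵐ d ∂law ρ χ c, d.after n ∈ A := by
  induction n with
  | zero => exact hA'
  | succ n ih =>
    intro c
    have h1 : law ρ χ c (Data.step ⁻¹' {d | d.after n ∈ A}ᶜ) ≤ 0 :=
      h.law_step_le (measurable_after n hA).compl (fun c => (ae_iff.1 (ih c)).le) c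
    exact ae_iff.2 (le_zero_iff.1 h1)

theorem law_wait_le (h : IsHomogeneous lam mu mu12 ρ) (c : Config) {t : ℝ} (ht : 0 ≤ t) :
    law ρ χ c {d | d.wait ≤ ENNReal.ofReal t} =
      ENNReal.ofReal (1 - Real.exp (-(sojournRate lam mu mu12 c.number * t))) := by
  have h1 : {d : Data | d.wait ≤ ENNReal.ofReal t} = {d | ENNReal.ofReal t < d.wait}ᶜ := by
    ext; simp
  rw [h1, prob_compl_eq_one_sub (measurableSet_lt_wait _), h.law_lt_wait c ht,
    ENNReal.ofReal_sub _ (Real.exp_nonneg _), ENNReal.ofReal_one]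

theorem law_wait_le_le (h : IsHomogeneous lam mu mu12 ρ) (c : Config) {t : ℝ} (ht : 0 ≤ t) :
    law ρ χ c {d | d.wait ≤ ENNReal.ofReal t} ≤
      ENNReal.ofReal (1 - Real.exp (-((lam + 2 * mu + mu12) * t))) := by
  rw [h.law_wait_le c ht]
  refine ENNReal.ofReal_le_ofReal (sub_le_sub_left (Real.exp_le_exp.2 (neg_le_neg ?_)) _)
  exact mul_le_mul_of_nonneg_right (h.sojournRate_le _) ht

theorem ae_wait_pos (h : IsHomogeneous lam mu mu12 ρ) (c : Config) :
    ∀ᵐ d ∂law ρ χ c, 0 < d.wait := by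
  have h1 := h.law_lt_wait (χ := χ) c le_rfl
  rw [ENNReal.ofReal_zero, mul_zero, neg_zero, Real.exp_zero, ENNReal.ofReal_one] at h1
  exact (mem_ae_iff_prob_eq_one (measurableSet_lt_wait 0)).2 h1

theorem ae_wait_lt_top (h : IsHomogeneous lam mu mu12 ρ) (c : Config) :
    ∀ᵐ d ∂law ρ χ c, d.wait < ⊤ := by
  have h1 : ∀ n : ℕ, law ρ χ c {d | d.wait = ⊤} ≤
      ENNReal.ofReal (Real.exp (-(sojournRate lam mu mu12 c.number * n))) := fun n => by
    rw [← h.law_lt_wait (χ := χ) c n.cast_nonneg]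
    refine measure_mono fun d hd => ?_
    rw [Set.mem_ofPred_eq] at hd ⊢
    rw [hd]
    exact ENNReal.ofReal_lt_top
  have h2 : Tendsto (fun n : ℕ =>
      ENNReal.ofReal (Real.exp (-(sojournRate lam mu mu12 c.number * n)))) atTop (𝓝 0) := by
    rw [← ENNReal.ofReal_zero]
    refine ENNReal.tendsto_ofReal (Real.tendsto_exp_atBot.comp ?_)
    exact tendsto_neg_atTop_atBot.comp
      (tendsto_natCast_atTop_atTop.const_mul_atTop (h.sojournRate_pos _))
  have h3 : law ρ χ c {d | d.wait = ⊤} = 0 :=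
    le_zero_iff.1 (ge_of_tendsto' h2 h1)
  have h4 : ∀ᵐ d ∂law ρ χ c, d.wait ≠ ⊤ := by
    rw [ae_iff]; simpa using h3
  exact h4.mono fun d hd => lt_top_iff_ne_top.2 hd

/-- Whatever the configuration, a wait is at most `1` with probability at most `q < 1`; since each
wait is independent of what follows, `n` such waits in a row have probability at most `q ^ n`. -/
theorem ae_exists_one_lt_wait (h : IsHomogeneous lam mu mu12 ρ) (c : Config) :
    ∀ᵐ d ∂law ρ χ c, ∃ n, 1 < (d.after n).wait := by
  set q : ℝ≥0∞ := ENNReal.ofReal (1 - Real.exp (-((lam + 2 * mu + mu12) * 1)))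
  have hq : q < 1 := by
    rw [← ENNReal.ofReal_one]
    refine (ENNReal.ofReal_lt_ofReal_iff one_pos).2 ?_
    linarith [Real.exp_pos (-((lam + 2 * mu + mu12) * 1))]
  have hm : ∀ n, MeasurableSet {d : Data | ∀ k < n, (d.after k).wait ≤ 1} := fun n => by
    have : {d : Data | ∀ k < n, (d.after k).wait ≤ 1} =
        ⋂ k ∈ Finset.range n, {d | (d.after k).wait ≤ 1} := by ext; simp
    rw [this]
    exact Finset.measurableSet_biInter _ fun k _ =>
      measurableSet_le (measurable_wait.comp (measurable_after k)) measurable_const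
  have key : ∀ n c, law ρ χ c {d | ∀ k < n, (d.after k).wait ≤ 1} ≤ q ^ n := fun n => by
    induction n with
    | zero => intro c; simp
    | succ n ih =>
      intro c
      have h1 : {d : Data | ∀ k < n + 1, (d.after k).wait ≤ 1} =
          Data.wait ⁻¹' Set.Iic 1 ∩ Data.step ⁻¹' {d | ∀ k < n, (d.after k).wait ≤ 1} := by
        ext d
        simp only [Set.mem_inter_iff, Set.mem_preimage, Set.mem_Iic, Set.mem_ofPred_eq]
        constructor
        · exact fun h => ⟨h 0 n.succ_pos, fun k hk => h (k + 1) (Nat.succ_lt_succ hk)⟩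
        · rintro ⟨h0, h⟩ k hk
          cases k with
          | zero => exact h0
          | succ k => exact h k (Nat.lt_of_succ_lt_succ hk)
      rw [h1, (indepFun_wait_step h.memoryless c).measure_inter_preimage_eq_mul _ _
        measurableSet_Iic (hm n), pow_succ']
      refine mul_le_mul' ?_ (h.law_step_le (hm n) ih c)
      have := h.law_wait_le_le (χ := χ) c zero_le_one
      rwa [ENNReal.ofReal_one] at this
  have h2 : law ρ χ c {d | ∀ n, (d.after n).wait ≤ 1} = 0 := by
    refine le_zero_iff.1 (ge_of_tendsto' (ENNReal.tendsto_pow_atTop_nhds_zero_of_lt_one hq)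
      fun n => (measure_mono fun d hd => ?_).trans (key n c))
    exact fun k _ => hd k
  rw [ae_iff]
  simpa using h2

/-- Applied after each of the first `m` events, the previous lemma yields infinitely many waits
longer than `1`. -/
theorem ae_nonExplosive (h : IsHomogeneous lam mu mu12 ρ) (c : Config) :
    ∀ᵐ d ∂law ρ χ c, d.NonExplosive := by
  have hm : MeasurableSet {d : Data | ∃ n, 1 < (d.after n).wait} := by
    have : {d : Data | ∃ n, 1 < (d.after n).wait} = ⋃ n, {d | 1 < (d.after n).wait} := by
      ext; simp
    rw [this]
    exact MeasurableSet.iUnion fun n =>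
      measurableSet_lt measurable_const (measurable_wait.comp (measurable_after n))
  have h1 := ae_all_iff.2 fun m => h.ae_after hm (h.ae_exists_one_lt_wait (χ := χ)) m c
  filter_upwards [h1] with d hd
  intro N
  induction N with
  | zero => exact ⟨0, by simp⟩
  | succ N ih =>
    obtain ⟨n, hn⟩ := ih
    obtain ⟨k, hk⟩ := hd n
    rw [Data.after_after] at hk
    refine ⟨k + n + 1, ?_⟩
    rw [Data.time_succ', Nat.cast_succ]
    exact add_le_add (hn.trans (d.time_mono (Nat.le_add_left n k))) hk.le

end IsHomogeneous

end NonExplosion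

/-! ### The number of customers -/

section NumberAt

theorem Data.numberAt_eq {d : Data} {t : ℝ≥0} {m : ℕ} (h1 : d.time m ≤ t)
    (h2 : (t : ℝ≥0∞) < d.time (m + 1)) : d.numberAt t = (d.after m).config.number := by
  classical
  have hex : ∃ n, d.time n ≤ t ∧ (t : ℝ≥0∞) < d.time (n + 1) := ⟨m, h1, h2⟩
  have huniq : ∀ n, d.time n ≤ t ∧ (t : ℝ≥0∞) < d.time (n + 1) → n = m := by
    rintro n ⟨h3, h4⟩
    rcases lt_trichotomy n m with h | h | h
    · exact absurd (h4.trans_le (d.time_mono h)) (not_lt.2 h1)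
    · exact h
    · exact absurd (h2.trans_le (d.time_mono h)) (not_lt.2 h3)
  rw [Data.numberAt, dif_pos hex]
  congr 3
  exact huniq _ (Nat.find_spec hex)

theorem Data.NonExplosive.exists_time {d : Data} (hd : d.NonExplosive) (t : ℝ≥0) :
    ∃ m, d.time m ≤ t ∧ (t : ℝ≥0∞) < d.time (m + 1) := by
  classical
  have hex : ∃ n, (t : ℝ≥0∞) < d.time n := by
    obtain ⟨N, hN⟩ := exists_nat_gt t
    obtain ⟨n, hn⟩ := hd N
    exact ⟨n, lt_of_lt_of_le (by exact_mod_cast hN) hn⟩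
  have h1 := Nat.find_spec hex
  have h0 : Nat.find hex ≠ 0 := fun h => by
    rw [h, Data.time_zero] at h1
    exact not_lt_bot h1
  obtain ⟨m, hm⟩ := Nat.exists_eq_succ_of_ne_zero h0
  refine ⟨m, not_lt.1 (Nat.find_min hex (by omega)), ?_⟩
  rwa [hm] at h1

theorem measurable_numberAt (t : ℝ≥0) : Measurable fun d : Data => d.numberAt t := by
  classical
  have hm : ∀ m, MeasurableSet {d : Data | d.time m ≤ t ∧ (t : ℝ≥0∞) < d.time (m + 1)} := fun m =>
    (measurableSet_le (measurable_time m) measurable_const).inter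
      (measurableSet_lt measurable_const (measurable_time (m + 1)))
  refine measurable_to_countable' fun j => ?_
  -- The second part of the union accounts for the default value `0` on exploding data.
  have : (fun d : Data => d.numberAt t) ⁻¹' {j} =
      (⋃ m, {d : Data | d.time m ≤ t ∧ (t : ℝ≥0∞) < d.time (m + 1)} ∩
        {d | (d.after m).config.number = j}) ∪
      ((⋂ m, {d : Data | d.time m ≤ t ∧ (t : ℝ≥0∞) < d.time (m + 1)}ᶜ) ∩ {_d | 0 = j}) := by
    ext d
    simp only [Set.mem_preimage, Set.mem_singleton_iff, Set.mem_union, Set.mem_iUnion,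
      Set.mem_inter_iff, Set.mem_iInter, Set.mem_compl_iff, Set.mem_ofPred_eq]
    by_cases hex : ∃ m, d.time m ≤ t ∧ (t : ℝ≥0∞) < d.time (m + 1)
    · obtain ⟨m, h1, h2⟩ := hex
      constructor
      · intro hj
        exact Or.inl ⟨m, ⟨h1, h2⟩, (Data.numberAt_eq h1 h2).symm.trans hj⟩
      · rintro (⟨n, ⟨h3, h4⟩, hj⟩ | ⟨h3, -⟩)
        · exact (Data.numberAt_eq h3 h4).trans hj
        · exact absurd ⟨h1, h2⟩ (h3 m)
    · rw [Data.numberAt, dif_neg hex]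
      push Not at hex
      constructor
      · exact fun hj => Or.inr ⟨fun m h => absurd h.2 (not_lt.2 (hex m h.1)), hj⟩
      · rintro (⟨n, ⟨h3, h4⟩, -⟩ | ⟨-, h3⟩)
        · exact absurd h4 (not_lt.2 (hex n h3))
        · exact h3
  rw [this]
  refine .union (.iUnion fun m => (hm m).inter ?_) (.inter (.iInter fun m => (hm m).compl) (.const _))
  exact (measurable_number.comp (measurable_after m)) (measurableSet_singleton j)

/-- The event that `m` events occur up to time `t`, that there are then `j` customers, and that
the data at time `t` are in `A`. -/
def occupation (m : ℕ) (j : ℕ) (A : Set Data) (t : ℝ≥0∞) : Set Data :=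
  {d | (d.time m ≤ t ∧ t < d.time (m + 1)) ∧ (d.after m).config.number = j ∧
    (d.after m).age (t - d.time m) ∈ A}

theorem measurableSet_occupation (m j : ℕ) {A : Set Data} (hA : MeasurableSet A) :
    MeasurableSet {z : ℝ≥0∞ × Data | z.2 ∈ occupation m j A z.1} := by
  have h1 : Measurable fun z : ℝ≥0∞ × Data => z.2.time m := (measurable_time m).comp measurable_snd
  have h2 : Measurable fun z : ℝ≥0∞ × Data => z.2.time (m + 1) :=
    (measurable_time (m + 1)).comp measurable_snd
  have h3 : Measurable fun z : ℝ≥0∞ × Data => z.2.after m :=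
    (measurable_after m).comp measurable_snd
  refine .inter (.inter (measurableSet_le h1 measurable_fst) (measurableSet_lt measurable_fst h2))
    (.inter ((measurable_number.comp h3) (measurableSet_singleton j)) ?_)
  exact (measurable_age.comp ((measurable_fst.sub h1).prodMk h3)) hA

theorem measurableSet_occupation_right (m j : ℕ) {A : Set Data} (hA : MeasurableSet A)
    (t : ℝ≥0∞) : MeasurableSet (occupation m j A t) :=
  measurable_prodMk_left (measurableSet_occupation m j hA)

/-- This is the recursion at the first event on which the induction over the number of events runs.
-/
theorem mem_occupation_succ {m j : ℕ} {A : Set Data} {t : ℝ≥0∞} (ht : t ≠ ⊤) {d : Data} :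
    d ∈ occupation (m + 1) j A t ↔ d.wait ≤ t ∧ d.step ∈ occupation m j A (t - d.wait) := by
  simp only [occupation, Set.mem_ofPred_eq, Data.time_succ, Data.after_succ,
    tsub_add_eq_tsub_tsub]
  constructor
  · rintro ⟨⟨h1, h2⟩, h3⟩
    have hw : d.wait ≤ t := le_self_add.trans h1
    refine ⟨hw, ⟨?_, ?_⟩, h3⟩
    · exact ENNReal.le_sub_of_add_le_left (ne_top_of_le_ne_top ht hw) h1
    · exact ENNReal.sub_lt_of_lt_add hw (by rwa [add_comm])
  · rintro ⟨hw, ⟨h1, h2⟩, h3⟩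
    refine ⟨⟨?_, ?_⟩, h3⟩
    · rw [add_comm]; exact add_le_of_le_tsub_right_of_le hw h1
    · exact (ENNReal.sub_lt_iff_lt_left (ne_top_of_le_ne_top ht hw) hw).1 h2

/-- After time `t` the data evolve like the data aged to time `t`, because ageing within a waiting
period does not affect later events. -/
theorem numberAt_add {d : Data} (hd : d.NonExplosive) {m : ℕ} {t s : ℝ≥0} (h1 : d.time m ≤ t)
    (h2 : (t : ℝ≥0∞) < d.time (m + 1)) :
    d.numberAt (t + s) = ((d.after m).age (t - d.time m)).numberAt s := by
  obtain ⟨n, h3, h4⟩ := hd.exists_time (t + s)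
  have hmt : d.time m ≠ ⊤ := ne_top_of_le_ne_top ENNReal.coe_ne_top h1
  set u : ℝ≥0∞ := t - d.time m with hu
  have hu' : d.time m + u = t := add_tsub_cancel_of_le h1
  have hut : u ≠ ⊤ := ENNReal.sub_ne_top ENNReal.coe_ne_top
  have huw : u < (d.after m).wait := by
    rw [Data.time_succ', ← hu'] at h2
    exact (ENNReal.add_lt_add_iff_left hmt).1 h2
  -- The event times match from index `k + 1` on only: event `m` may lie strictly before `t`,
  -- whereas the aged data have `time 0 = 0`.
  have htime : ∀ k, d.time (m + k + 1) = t + ((d.after m).age u).time (k + 1) := by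
    intro k
    induction k with
    | zero =>
      rw [add_zero, Data.time_succ', Data.time_succ ((d.after m).age u), Data.time_zero, add_zero,
        Data.wait_age hut, ← hu', add_assoc, add_tsub_cancel_of_le huw.le]
    | succ k ih =>
      rw [Data.time_succ', ← add_assoc, ih, Data.time_succ' _ (k + 1), ← add_assoc]
      congr 2
      rw [Data.after_succ ((d.after m).age u), Data.step_age huw, ← Data.after_succ, Data.after_after]
      congr 1; omega
  have hmn : m ≤ n := by
    by_contra h
    have h5 := h4.trans_le ((d.time_mono (show n + 1 ≤ m by omega)).trans h1)
    rw [ENNReal.coe_add] at h5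
    exact absurd h5 (not_lt.2 le_self_add)
  obtain ⟨k, rfl⟩ := Nat.exists_eq_add_of_le hmn
  rw [Data.numberAt_eq h3 h4]
  rw [htime k, ENNReal.coe_add] at h4
  have h4' := (ENNReal.add_lt_add_iff_left ENNReal.coe_ne_top).1 h4
  cases k with
  | zero => rw [Data.numberAt_eq (m := 0) (by simp [Data.time_zero]) h4']; rfl
  | succ k =>
    rw [← add_assoc, htime k, ENNReal.coe_add] at h3
    have h3' := (ENNReal.add_le_add_iff_left ENNReal.coe_ne_top).1 h3
    rw [Data.numberAt_eq h3' h4', Data.after_succ, Data.step_age huw, ← Data.after_succ,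
      Data.after_after]
    congr 3; omega

end NumberAt

/-! ### The Markov property under fresh clocks -/

section Markov

/-- A configuration with `i` customers. -/
def configOf : ℕ → Config
  | 0 => .empty
  | 1 => .one 0
  | q + 2 => .both q

theorem number_configOf (i : ℕ) : (configOf i).number = i := by
  match i with
  | 0 => rfl
  | 1 => rfl
  | q + 2 => rfl

variable (ρ : Clock → Measure ℝ≥0∞) [∀ c, IsProbabilityMeasure (ρ c)]
  (χ : Measure (Fin 2)) [IsProbabilityMeasure χ]

/-- The probability that there are `j` customers at time `t`, if there are `i` customers and the
clocks are fresh at time `0`. -/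
noncomputable def transition (t : ℝ≥0) (i j : ℕ) : ℝ≥0∞ :=
  law ρ χ (configOf i) {d | d.numberAt t = j}

variable {ρ χ} {lam mu mu12 : ℝ}

theorem measurableSet_numberAt (t : ℝ≥0) (j : ℕ) : MeasurableSet {d : Data | d.numberAt t = j} :=
  measurable_numberAt t (measurableSet_singleton j)

theorem measurableSet_forall_numberAt (n : ℕ) (t : ℕ → ℝ≥0) (i : ℕ → ℕ) :
    MeasurableSet {d : Data | ∀ k ≤ n, d.numberAt (t k) = i k} := by
  have : {d : Data | ∀ k ≤ n, d.numberAt (t k) = i k} =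
      ⋂ k ∈ Finset.range (n + 1), {d | d.numberAt (t k) = i k} := by
    ext; simp
  rw [this]
  exact Finset.measurableSet_biInter _ fun k _ => measurableSet_numberAt _ _

theorem Data.NonExplosive.numberAt_eq_iff {d : Data} (hd : d.NonExplosive) (t : ℝ≥0) (j : ℕ) :
    d.numberAt t = j ↔ d ∈ ⋃ m, occupation m j Set.univ t := by
  obtain ⟨m, hm⟩ := hd.exists_time t
  rw [Set.mem_iUnion]
  constructor
  · exact fun hj => ⟨m, hm, (Data.numberAt_eq hm.1 hm.2).symm.trans hj, trivial⟩
  · rintro ⟨n, hn, hj, -⟩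
    exact (Data.numberAt_eq hn.1 hn.2).trans hj

theorem transition_ne_top (t : ℝ≥0) (i j : ℕ) : transition ρ χ t i j ≠ ⊤ := measure_ne_top _ _

theorem tsum_law_numberAt_and {B : Set Data} (hB : MeasurableSet B) (t : ℝ≥0) (c : Config) :
    ∑' k, law ρ χ c {d | d.numberAt t = k ∧ d ∈ B} = law ρ χ c B := by
  rw [← measure_iUnion]
  · congr 1
    ext d
    simp
  · intro k l hkl
    exact Set.disjoint_left.2 fun d hd hd' => hkl (hd.1.symm.trans hd'.1)
  · exact fun k => (measurableSet_numberAt t k).inter hB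

namespace IsHomogeneous

/-- The factor `g` is chosen before `A`, so it can be identified afterwards by taking `A =
Set.univ`. That it depends on `c` only through the number is lumpability; that `a` splits off is the
Markov property, given `m` events. -/
theorem exists_law_occupation (h : IsHomogeneous lam mu mu12 ρ) (m j : ℕ) :
    ∃ g : ℝ≥0∞ → ℕ → ℝ≥0∞, ∀ (A : Set Data), MeasurableSet A → ∀ a : ℝ≥0∞, a ≠ ⊤ →
      (∀ c, c.number = j → law ρ χ c A = a) → ∀ t : ℝ≥0∞, t ≠ ⊤ → ∀ c,
        law ρ χ c (occupation m j A t) = g t c.number * a := by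
  induction m with
  | zero =>
    refine ⟨fun t i => if i = j then law ρ χ (configOf i) {d | t < d.wait} else 0, ?_⟩
    intro A hA a _ hAa t ht c
    by_cases hc : c.number = j
    · have h1 : law ρ χ c (occupation 0 j A t) = law ρ χ c {d | t < d.wait ∧ d.age t ∈ A} := by
        refine measure_congr ?_
        filter_upwards [law_ae_config (ρ := ρ) (χ := χ) c] with d hd
        refine propext ?_
        change (_ ∧ _) ∧ _ ∧ _ ↔ _ ∧ _
        simp [Data.time_succ', Data.time_zero, Data.after_zero, hd, hc]
      have h2 : law ρ χ c {d | t < d.wait} = law ρ χ (configOf c.number) {d | t < d.wait} := by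
        rw [← ENNReal.ofReal_toReal ht, h.law_lt_wait _ ENNReal.toReal_nonneg,
          h.law_lt_wait _ ENNReal.toReal_nonneg, number_configOf]
      rw [h1, law_age h.memoryless c t hA, hAa c hc, h2]
      simp only [if_pos hc]
    · have h1 : law ρ χ c (occupation 0 j A t) = law ρ χ c ∅ := by
        refine measure_congr ?_
        filter_upwards [law_ae_config (ρ := ρ) (χ := χ) c] with d hd
        refine propext ?_
        change (_ ∧ _) ∧ _ ∧ _ ↔ False
        simp [Data.after_zero, hd, hc]
      rw [h1, measure_empty]
      simp only [if_neg hc, zero_mul]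
  | succ m ih =>
    obtain ⟨g, hg⟩ := ih
    -- Renewal equation: the first event occurs at `s`, moves the number by the embedded chain, and
    -- leaves `m` events for the time `t - s`.
    refine ⟨fun t i => ∫⁻ s, (if s ≤ t then jumpMean lam mu mu12 (g (t - s)) i else 0)
      ∂(law ρ χ (configOf i)).map Data.wait, ?_⟩
    intro A hA a ha hAa t ht c
    have hS : MeasurableSet {z : ℝ≥0∞ × Data | z.1 ≤ t ∧ z.2 ∈ occupation m j A (t - z.1)} := by
      refine .inter (measurableSet_le measurable_fst measurable_const) ?_
      exact ((measurable_const.sub measurable_fst).prodMk measurable_snd)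
        (measurableSet_occupation m j hA)
    have h1 : occupation (m + 1) j A t = {d | (d.wait, d.step) ∈
        {z : ℝ≥0∞ × Data | z.1 ≤ t ∧ z.2 ∈ occupation m j A (t - z.1)}} := by
      ext d; exact mem_occupation_succ ht
    rw [h1, law_eq_lintegral_wait h.memoryless c hS,
      h.map_wait_eq (number_configOf c.number).symm, ← lintegral_mul_const' _ _ ha]
    refine lintegral_congr fun s => ?_
    by_cases hs : s ≤ t
    · have h2 : {d | (s, d) ∈ {z : ℝ≥0∞ × Data | z.1 ≤ t ∧ z.2 ∈ occupation m j A (t - z.1)}} =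
          occupation m j A (t - s) := by
        ext d; exact and_iff_right hs
      rw [h2, if_pos hs, ← jumpMean_mul_const]
      exact h.law_step_eq_jumpMean (measurableSet_occupation_right m j hA _)
        (fun c' => hg A hA a ha hAa _ (ENNReal.sub_ne_top ht) c') c
    · have h2 : {d | (s, d) ∈ {z : ℝ≥0∞ × Data | z.1 ≤ t ∧ z.2 ∈ occupation m j A (t - z.1)}} =
          ∅ := by
        ext d; exact iff_of_false (fun h => hs h.1) id
      rw [h2, if_neg hs, Set.preimage_empty, measure_empty, zero_mul]

theorem law_iUnion_occupation (h : IsHomogeneous lam mu mu12 ρ) {A : Set Data}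
    (hA : MeasurableSet A) {a : ℝ≥0∞} (ha : a ≠ ⊤) {j : ℕ}
    (hAa : ∀ c, c.number = j → law ρ χ c A = a) (t : ℝ≥0) (c : Config) :
    law ρ χ c (⋃ m, occupation m j A t) = transition ρ χ t c.number j * a := by
  choose g hg using fun m => h.exists_law_occupation (χ := χ) m j
  have hU : ∀ B, MeasurableSet B → ∀ c, law ρ χ c (⋃ m, occupation m j B t) =
      ∑' m, law ρ χ c (occupation m j B t) := fun B hB c => by
    refine measure_iUnion ?_ fun m => measurableSet_occupation_right m j hB t
    intro m n hmn
    refine Set.disjoint_left.2 fun d hd hd' => ?_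
    rcases lt_or_gt_of_ne hmn with hlt | hlt
    · exact absurd (hd.1.2.trans_le (d.time_mono hlt)) (not_lt.2 hd'.1.1)
    · exact absurd (hd'.1.2.trans_le (d.time_mono hlt)) (not_lt.2 hd.1.1)
  -- The case `A = Set.univ`, `a = 1` identifies the sum of the factors.
  have hT : transition ρ χ t c.number j = ∑' m, g m t c.number := by
    have h1 : transition ρ χ t c.number j =
        law ρ χ (configOf c.number) (⋃ m, occupation m j Set.univ t) := by
      refine measure_congr ?_
      filter_upwards [h.ae_nonExplosive (χ := χ) (configOf c.number)] with d hd
      exact propext (hd.numberAt_eq_iff t j)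
    rw [h1, hU _ MeasurableSet.univ]
    refine tsum_congr fun m => ?_
    rw [hg m Set.univ MeasurableSet.univ 1 ENNReal.one_ne_top (fun _ _ => measure_univ) t
      ENNReal.coe_ne_top, mul_one, number_configOf]
  rw [hU A hA, hT, ← ENNReal.tsum_mul_right]
  exact tsum_congr fun m => hg m A hA a ha hAa t ENNReal.coe_ne_top c

/-- The Markov property. -/
theorem law_numberAt_and (h : IsHomogeneous lam mu mu12 ρ) (n : ℕ) (s : ℕ → ℝ≥0) (i : ℕ → ℕ)
    {a : ℝ≥0∞} (ha : a ≠ ⊤) {j : ℕ}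
    (hAa : ∀ c, c.number = j → law ρ χ c {d | ∀ k ≤ n, d.numberAt (s k) = i k} = a) (t : ℝ≥0)
    (c : Config) : law ρ χ c {d | d.numberAt t = j ∧ ∀ k ≤ n, d.numberAt (t + s k) = i k} =
      transition ρ χ t c.number j * a := by
  rw [← h.law_iUnion_occupation (measurableSet_forall_numberAt n s i) ha hAa]
  refine measure_congr ?_
  filter_upwards [h.ae_nonExplosive (χ := χ) c] with d hd
  refine propext ?_
  change (d.numberAt t = j ∧ ∀ k ≤ n, d.numberAt (t + s k) = i k) ↔ d ∈ ⋃ m, occupation m j _ t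
  rw [Set.mem_iUnion]
  constructor
  · rintro ⟨h1, h2⟩
    obtain ⟨m, hm⟩ := hd.exists_time t
    refine ⟨m, hm, (Data.numberAt_eq hm.1 hm.2).symm.trans h1, fun k hk => ?_⟩
    rw [← numberAt_add hd hm.1 hm.2]
    exact h2 k hk
  · rintro ⟨m, hm, h1, h2⟩
    refine ⟨(Data.numberAt_eq hm.1 hm.2).trans h1, fun k hk => ?_⟩
    rw [numberAt_add hd hm.1 hm.2]
    exact h2 k hk

/-- The server chosen in `configOf 1` is thereby immaterial. -/
theorem law_numberAt (h : IsHomogeneous lam mu mu12 ρ) (t : ℝ≥0) (j : ℕ) (c : Config) :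
    law ρ χ c {d | d.numberAt t = j} = transition ρ χ t c.number j := by
  have key : ∀ c, law ρ χ c {d | d.numberAt t = j} =
      law ρ χ c (⋃ m, occupation m j Set.univ t) := fun c => by
    refine measure_congr ?_
    filter_upwards [h.ae_nonExplosive (χ := χ) c] with d hd
    exact propext (hd.numberAt_eq_iff t j)
  rw [key, h.law_iUnion_occupation MeasurableSet.univ ENNReal.one_ne_top
    (fun _ _ => measure_univ), mul_one]

/-- The finite-dimensional distributions. -/
theorem law_forall_numberAt (h : IsHomogeneous lam mu mu12 ρ) (n : ℕ) :
    ∀ (t : ℕ → ℝ≥0) (i : ℕ → ℕ), Monotone t → ∀ c : Config,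
      law ρ χ c {d | ∀ k ≤ n, d.numberAt (t k) = i k} = transition ρ χ (t 0) c.number (i 0) *
        ∏ k ∈ Finset.range n, transition ρ χ (t (k + 1) - t k) (i k) (i (k + 1)) := by
  induction n with
  | zero =>
    intro t i _ c
    simp [← h.law_numberAt]
  | succ n ih =>
    intro t i ht c
    -- The clock is restarted at `t 0`, and the induction hypothesis is used for the remaining times
    -- measured from there.
    have hmono : Monotone fun k => t (k + 1) - t 0 := fun a b hab =>
      tsub_le_tsub_right (ht (Nat.succ_le_succ hab)) _
    have h1 : {d : Data | ∀ k ≤ n + 1, d.numberAt (t k) = i k} = {d | d.numberAt (t 0) = i 0 ∧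
        ∀ k ≤ n, d.numberAt (t 0 + (t (k + 1) - t 0)) = i (k + 1)} := by
      ext d
      simp only [Set.mem_ofPred_eq, add_tsub_cancel_of_le (ht (Nat.zero_le _))]
      constructor
      · exact fun h => ⟨h 0 (Nat.zero_le _), fun k hk => h (k + 1) (Nat.succ_le_succ hk)⟩
      · rintro ⟨h0, h⟩ k hk
        cases k with
        | zero => exact h0
        | succ k => exact h k (Nat.le_of_succ_le_succ hk)
    have h2 : ∀ c : Config, c.number = i 0 →
        law ρ χ c {d | ∀ k ≤ n, d.numberAt (t (k + 1) - t 0) = i (k + 1)} =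
        ∏ k ∈ Finset.range (n + 1), transition ρ χ (t (k + 1) - t k) (i k) (i (k + 1)) := by
      intro c hc
      rw [ih _ (fun k => i (k + 1)) hmono c, hc, Finset.prod_range_succ', mul_comm]
      congr 1
      refine Finset.prod_congr rfl fun k _ => ?_
      rw [tsub_tsub_tsub_cancel_right (ht (Nat.zero_le _))]
    rw [h1]
    exact h.law_numberAt_and n _ (fun k => i (k + 1))
      (ENNReal.prod_ne_top fun k _ => transition_ne_top _ _ _) h2 (t 0) c

/-! ### The transition function -/

theorem transition_zero (h : IsHomogeneous lam mu mu12 ρ) (i j : ℕ) :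
    transition ρ χ 0 i j = if i = j then 1 else 0 := by
  have h1 : ∀ᵐ d ∂law ρ χ (configOf i), d.numberAt 0 = i := by
    filter_upwards [h.ae_wait_pos (χ := χ) (configOf i), law_ae_config (ρ := ρ) (χ := χ)
      (configOf i)] with d hd hc
    rw [Data.numberAt_eq (m := 0) (by simp [Data.time_zero])
      (by simpa [Data.time_succ', Data.time_zero, Data.after_zero] using hd), Data.after_zero, hc,
      number_configOf]
  split_ifs with hij
  · subst hij
    exact (mem_ae_iff_prob_eq_one (measurableSet_numberAt 0 i)).1 h1
  · refine measure_mono_null (fun d hd => ?_) (ae_iff.1 h1)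
    exact fun hd' : d.numberAt 0 = i => hij (hd'.symm.trans hd)

/-- The event is split according to the state at time `s`; each piece is the Markov property with a
single later time. -/
theorem chapman_kolmogorov (h : IsHomogeneous lam mu mu12 ρ) (s t : ℝ≥0) (i j : ℕ) :
    ∑' k, transition ρ χ s i k * transition ρ χ t k j = transition ρ χ (s + t) i j := by
  rw [transition, ← tsum_law_numberAt_and (measurableSet_numberAt (s + t) j) s]
  refine tsum_congr fun k => ?_
  have := h.law_numberAt_and (χ := χ) 0 (fun _ => t) (fun _ => j) (j := k)
    (transition_ne_top (ρ := ρ) (χ := χ) t k j)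
    (fun c hc => by simp [h.law_numberAt, hc]) s (configOf i)
  rw [number_configOf] at this
  rw [← this]
  simp

/-- The transition function, up to two events. -/
theorem abs_transition_sub_le (h : IsHomogeneous lam mu mu12 ρ) (t : ℝ≥0) (i j : ℕ) :
    |(transition ρ χ t i j).toReal -
      ((if i = j then Real.exp (-(sojournRate lam mu mu12 i * t)) else 0) +
        (1 - Real.exp (-(sojournRate lam mu mu12 i * t))) * jumpProb lam mu mu12 i j)| ≤
      (1 - Real.exp (-((lam + 2 * mu + mu12) * t))) ^ 2 := by
  set c := configOf i with hc
  set P := law ρ χ c with hP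
  have hcn : c.number = i := number_configOf i
  have ht : ENNReal.ofReal (t : ℝ) = (t : ℝ≥0∞) := ENNReal.ofReal_coe_nnreal
  have hexp : ∀ x : ℝ, 0 ≤ x → 0 ≤ 1 - Real.exp (-x) := fun x hx =>
    sub_nonneg.2 (Real.exp_le_one_iff.2 (neg_nonpos.2 hx))
  have hθ : 0 ≤ sojournRate lam mu mu12 i * t :=
    mul_nonneg (h.sojournRate_pos i).le t.coe_nonneg
  have hΘ : 0 ≤ (lam + 2 * mu + mu12) * t :=
    mul_nonneg ((h.sojournRate_pos i).le.trans (h.sojournRate_le i)) t.coe_nonneg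
  have hnum : MeasurableSet {d : Data | d.config.number = j} :=
    measurable_number (measurableSet_singleton j)
  have hwm : MeasurableSet {d : Data | d.wait ≤ t} :=
    measurableSet_le measurable_wait measurable_const
  -- `B0` is the contribution of no event and `B1` that of a first jump to `j`. `B2` contains the
  -- event of two or more jumps up to `t`, as both waits are then at most `t`; unlike that event, it
  -- has a probability that factors.
  set B0 : Set Data := {d | d.config.number = j} ∩ {d | (t : ℝ≥0∞) < d.wait} with hB0
  set B1 : Set Data := Data.wait ⁻¹' Set.Iic (t : ℝ≥0∞) ∩
    Data.step ⁻¹' {d | d.config.number = j} with hB1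
  set B2 : Set Data := Data.wait ⁻¹' Set.Iic (t : ℝ≥0∞) ∩ Data.step ⁻¹' {d | d.wait ≤ t} with hB2
  have hB0m : MeasurableSet B0 := hnum.inter (measurableSet_lt_wait t)
  have hB1m : MeasurableSet B1 := (measurable_wait measurableSet_Iic).inter (measurable_step hnum)
  have hwait : P (Data.wait ⁻¹' Set.Iic (t : ℝ≥0∞)) =
      ENNReal.ofReal (1 - Real.exp (-(sojournRate lam mu mu12 i * t))) := by
    have := h.law_wait_le (χ := χ) c t.coe_nonneg
    rwa [ht, hcn] at this
  have hP0 : P.real B0 =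
      if i = j then Real.exp (-(sojournRate lam mu mu12 i * t)) else 0 := by
    have h1 : P B0 = if i = j then P {d | (t : ℝ≥0∞) < d.wait} else 0 := by
      rw [hP, hB0, law_number_inter, hcn]
    have h2 := h.law_lt_wait (χ := χ) c t.coe_nonneg
    rw [ht, hcn] at h2
    rw [measureReal_def, h1, h2]
    split_ifs
    · exact ENNReal.toReal_ofReal (Real.exp_nonneg _)
    · rfl
  have hP1 : P.real B1 =
      (1 - Real.exp (-(sojournRate lam mu mu12 i * t))) * jumpProb lam mu mu12 i j := by
    have h1 : P (Data.step ⁻¹' {d | d.config.number = j}) =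
        ENNReal.ofReal (jumpProb lam mu mu12 i j) := by
      rw [h.law_step_eq_jumpMean hnum (g := fun l => if l = j then 1 else 0) ?_ c,
        jumpMean_single, mul_one, hcn]
      intro c'
      rw [← Set.inter_univ {d : Data | d.config.number = j}, law_number_inter, measure_univ]
    rw [measureReal_def, hB1, (indepFun_wait_step h.memoryless c).measure_inter_preimage_eq_mul _ _
      measurableSet_Iic hnum, hwait, h1, ENNReal.toReal_mul, ENNReal.toReal_ofReal (hexp _ hθ),
      ENNReal.toReal_ofReal (h.jumpProb_nonneg i j)]
  have hP2 : P.real B2 ≤ (1 - Real.exp (-((lam + 2 * mu + mu12) * t))) ^ 2 := by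
    have hle : ∀ c, law ρ χ c {d | d.wait ≤ t} ≤
        ENNReal.ofReal (1 - Real.exp (-((lam + 2 * mu + mu12) * t))) := fun c => by
      have := h.law_wait_le_le (χ := χ) c t.coe_nonneg
      rwa [ht] at this
    rw [measureReal_def, hB2, (indepFun_wait_step h.memoryless c).measure_inter_preimage_eq_mul _ _
      measurableSet_Iic hwm, ENNReal.toReal_mul, sq]
    refine mul_le_mul ?_ ?_ ENNReal.toReal_nonneg (hexp _ hΘ)
    · exact ENNReal.toReal_le_of_le_ofReal (hexp _ hΘ) (hle c)
    · exact ENNReal.toReal_le_of_le_ofReal (hexp _ hΘ) (h.law_step_le hwm hle c)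
  have hdisj : Disjoint B0 B1 :=
    Set.disjoint_left.2 fun d h0 h1 => not_lt.2 (show d.wait ≤ t from h1.1) h0.2
  rw [← hP0, ← hP1, ← measureReal_union hdisj hB1m]
  refine le_trans (abs_measureReal_sub_le_measureReal_symmDiff
    (measurableSet_numberAt t j).nullMeasurableSet (hB0m.union hB1m).nullMeasurableSet) ?_
  refine le_trans (measureReal_mono ?_) hP2
  intro d hd
  by_contra hd2
  -- Outside `B2` at most one event occurs up to time `t`, so the number at `t` is read off before
  -- or after it.
  have key : d.numberAt t = j ↔ d ∈ B0 ∪ B1 := by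
    by_cases hw : (t : ℝ≥0∞) < d.wait
    · rw [Data.numberAt_eq (m := 0) (by simp [Data.time_zero])
        (by simpa [Data.time_succ', Data.time_zero, Data.after_zero] using hw), Data.after_zero]
      constructor
      · exact fun hj => Or.inl ⟨hj, hw⟩
      · rintro (h0 | h1)
        · exact h0.1
        · exact absurd hw (not_lt.2 h1.1)
    · have hw' : (t : ℝ≥0∞) < d.step.wait := by
        by_contra h3
        exact hd2 ⟨not_lt.1 hw, not_lt.1 h3⟩
      rw [Data.numberAt_eq (m := 1)
        (by simpa [Data.time_succ', Data.time_zero, Data.after_zero] using hw)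
        (by rw [Data.time_succ, Data.time_succ, Data.time_zero, add_zero]
            exact hw'.trans_le le_add_self)]
      constructor
      · exact fun hj => Or.inr ⟨not_lt.1 hw, hj⟩
      · rintro (h0 | h1)
        · exact absurd h0.2 hw
        · exact h1.2
  rcases hd with ⟨h1, h2⟩ | ⟨h1, h2⟩
  · exact h2 (key.1 h1)
  · exact h2 (key.2 h1)

/-- The approximation with at most one event has an explicit derivative at `0`, and the error is at
most `(Θ t)²` because `1 - e^{-x} ≤ x`. -/
theorem hasDerivWithinAt_transition (h : IsHomogeneous lam mu mu12 ρ) (i j : ℕ) :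
    HasDerivWithinAt (fun t : ℝ => (transition ρ χ t.toNNReal i j).toReal) (Q0 lam mu mu12 i j)
      (Set.Ici 0) 0 := by
  set θ := sojournRate lam mu mu12 i with hθ
  set r := jumpProb lam mu mu12 i j with hr
  set f : ℝ → ℝ := fun t =>
    (if i = j then Real.exp (-(θ * t)) else 0) + (1 - Real.exp (-(θ * t))) * r with hf
  set e : ℝ → ℝ := fun t => (transition ρ χ t.toNNReal i j).toReal - f t with he
  set Θ := lam + 2 * mu + mu12 with hΘ
  have hΘ0 : 0 ≤ Θ := (h.sojournRate_pos 0).le.trans (h.sojournRate_le 0)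
  have hexp : HasDerivAt (fun t : ℝ => Real.exp (-(θ * t))) (-θ) 0 := by
    have h1 : HasDerivAt (fun t : ℝ => -(θ * t)) (-θ) 0 := by
      simpa only [neg_mul, mul_one] using (hasDerivAt_id' (0 : ℝ)).const_mul (-θ)
    simpa using h1.exp
  have hf' : HasDerivAt f (Q0 lam mu mu12 i j) 0 := by
    have h1 := (hexp.const_sub 1).mul_const r
    by_cases hij : i = j
    · have h2 := hexp.add h1
      have h3 : r = 0 := by rw [hr, jumpProb, if_pos hij]
      simp only [hf, if_pos hij]
      refine h2.congr_deriv ?_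
      rw [h3, ← hij, Q0_diag]; ring
    · have h2 := (hasDerivAt_const (0 : ℝ) (0 : ℝ)).add h1
      simp only [hf, if_neg hij]
      refine h2.congr_deriv ?_
      rw [h.Q0_off_diag hij]; ring
  have hbound : ∀ t : ℝ, 0 ≤ t → |e t| ≤ Θ ^ 2 * t ^ 2 := fun t ht => by
    have h1 := h.abs_transition_sub_le (χ := χ) t.toNNReal i j
    rw [Real.coe_toNNReal t ht] at h1
    refine h1.trans ?_
    rw [← mul_pow]
    have h2 : 0 ≤ Θ * t := mul_nonneg hΘ0 ht
    refine pow_le_pow_left₀ (sub_nonneg.2 (Real.exp_le_one_iff.2 (neg_nonpos.2 h2))) ?_ 2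
    linarith [Real.add_one_le_exp (-(Θ * t))]
  have he0 : e 0 = 0 := by
    have := hbound 0 le_rfl
    simpa using this
  have he' : HasDerivWithinAt e 0 (Set.Ici 0) 0 := by
    rw [hasDerivWithinAt_iff_isLittleO]
    simp only [he0, sub_zero, smul_zero]
    have h1 : e =O[𝓝[Set.Ici 0] 0] fun t : ℝ => t ^ 2 := by
      refine Asymptotics.IsBigO.of_bound (Θ ^ 2) ?_
      filter_upwards [self_mem_nhdsWithin] with t ht
      rw [Real.norm_eq_abs, Real.norm_eq_abs, abs_of_nonneg (sq_nonneg t)]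
      exact hbound t ht
    exact h1.trans_isLittleO
      ((Asymptotics.isLittleO_pow_id one_lt_two).mono nhdsWithin_le_nhds)
  have := he'.add hf'.hasDerivWithinAt
  rw [zero_add] at this
  refine this.congr_of_mem (fun t _ => ?_) (Set.mem_Ici.2 le_rfl)
  simp [he]

theorem isTransitionFunction (h : IsHomogeneous lam mu mu12 ρ) :
    IsTransitionFunction fun t i j => (transition ρ χ t i j).toReal where
  nonneg _ _ _ := ENNReal.toReal_nonneg
  sum_one t i := by
    have h1 := tsum_law_numberAt_and (ρ := ρ) (χ := χ) MeasurableSet.univ t (configOf i)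
    simp only [Set.mem_univ, and_true, measure_univ] at h1
    have h2 := ENNReal.hasSum_toReal (f := transition ρ χ t i) (by simp [transition, h1])
    rw [← ENNReal.tsum_toReal_eq fun j => transition_ne_top t i j] at h2
    simpa [transition, h1] using h2
  zero_same i := by simp [h.transition_zero]
  zero_ne i j hij := by simp [h.transition_zero, hij]
  chapman_kolmogorov s t i j := by
    have h1 := h.chapman_kolmogorov (χ := χ) s t i j
    have h2 := ENNReal.hasSum_toReal
      (f := fun k => transition ρ χ s i k * transition ρ χ t k j)
      (by rw [h1]; exact transition_ne_top _ _ _)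
    rw [← ENNReal.tsum_toReal_eq fun k => ENNReal.mul_ne_top (transition_ne_top s i k)
      (transition_ne_top t k j), h1] at h2
    simpa only [ENNReal.toReal_mul] using h2

end IsHomogeneous

end Markov

/-! ### The sojourn times and the embedded chain under fresh clocks -/

section JumpChain

variable {ρ : Clock → Measure ℝ≥0∞} {lam mu mu12 : ℝ}

/-- The event that the embedded chain and the sojourn times satisfy the given constraints. -/
def jumpPath (n : ℕ) (i : ℕ → ℕ) (u : ℕ → ℝ≥0) : Set Data :=
  {d | (∀ k ≤ n, (d.after k).config.number = i k) ∧ ∀ k < n, (u k : ℝ≥0∞) < (d.after k).wait}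

theorem measurableSet_jumpPath (n : ℕ) (i : ℕ → ℕ) (u : ℕ → ℝ≥0) :
    MeasurableSet (jumpPath n i u) := by
  have : jumpPath n i u = (⋂ k ∈ Finset.range (n + 1), {d | (d.after k).config.number = i k}) ∩
      ⋂ k ∈ Finset.range n, {d | (u k : ℝ≥0∞) < (d.after k).wait} := by
    ext; simp [jumpPath]
  rw [this]
  refine .inter (Finset.measurableSet_biInter _ fun k _ => ?_)
    (Finset.measurableSet_biInter _ fun k _ => ?_)
  · exact (measurable_number.comp (measurable_after k)) (measurableSet_singleton _)
  · exact measurableSet_lt measurable_const (measurable_wait.comp (measurable_after k))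

theorem jumpPath_succ (n : ℕ) (i : ℕ → ℕ) (u : ℕ → ℝ≥0) :
    jumpPath (n + 1) i u = {d | d.config.number = i 0} ∩ {d | (u 0 : ℝ≥0∞) < d.wait ∧
      d.step ∈ jumpPath n (fun k => i (k + 1)) fun k => u (k + 1)} := by
  ext d
  constructor
  · rintro ⟨h1, h2⟩
    exact ⟨h1 0 (Nat.zero_le _), h2 0 n.succ_pos, fun k hk => h1 (k + 1) (Nat.succ_le_succ hk),
      fun k hk => h2 (k + 1) (Nat.succ_lt_succ hk)⟩
  · rintro ⟨h1, h2, h3, h4⟩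
    refine ⟨fun k hk => ?_, fun k hk => ?_⟩
    · cases k with
      | zero => exact h1
      | succ k => exact h3 k (Nat.le_of_succ_le_succ hk)
    · cases k with
      | zero => exact h2
      | succ k => exact h4 k (Nat.lt_of_succ_lt_succ hk)

variable [∀ c, IsProbabilityMeasure (ρ c)] {χ : Measure (Fin 2)} [IsProbabilityMeasure χ]

/-- Each event contributes an independent factor for its wait. By induction the rest of the path has
a probability supported on the single state `i 1`, so the mean over the next jump reduces to one
term. -/
theorem IsHomogeneous.law_jumpPath (h : IsHomogeneous lam mu mu12 ρ) (n : ℕ) :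
    ∀ (i : ℕ → ℕ) (u : ℕ → ℝ≥0) (c : Config), law ρ χ c (jumpPath n i u) =
      if c.number = i 0 then ∏ k ∈ Finset.range n,
        ENNReal.ofReal (jumpProb lam mu mu12 (i k) (i (k + 1)) *
          Real.exp (-(sojournRate lam mu mu12 (i k) * u k))) else 0 := by
  induction n with
  | zero =>
    intro i u c
    have h1 : jumpPath 0 i u = {d | d.config.number = i 0} ∩ Set.univ := by
      ext d; simp [jumpPath, Data.after_zero]
    rw [h1, law_number_inter]
    simp
  | succ n ih =>
    intro i u c
    rw [jumpPath_succ, law_number_inter,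
      law_wait_step h.memoryless c _ (measurableSet_jumpPath n _ _),
      h.law_step_eq_jumpMean (measurableSet_jumpPath n _ _)
        (g := fun l => if l = i 1 then ∏ k ∈ Finset.range n,
          ENNReal.ofReal (jumpProb lam mu mu12 (i (k + 1)) (i (k + 2)) *
            Real.exp (-(sojournRate lam mu mu12 (i (k + 1)) * u (k + 1)))) else 0)
        (fun c => ih _ _ c), jumpMean_single]
    split_ifs with hc
    · have h2 := h.law_lt_wait (χ := χ) c (u 0).coe_nonneg
      rw [ENNReal.ofReal_coe_nnreal] at h2
      rw [h2, hc, Finset.prod_range_succ', ENNReal.ofReal_mul (p := jumpProb lam mu mu12 (i 0) _)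
        (h.jumpProb_nonneg _ _)]
      ring
    · rfl

end JumpChain

/-! ### The queue -/

section Queue

variable {Ω : Type*} [MeasurableSpace Ω] {P : Measure Ω}
  {lam mu mu12 p : ℝ} {C : Ω → Config} {T : Clock → ℕ → Ω → ℝ≥0∞} {R : ℕ → Ω → Fin 2}

/-- The data at time `0` in the queue driven by the input `C`, `T`, `R`. -/
def inputData (C : Ω → Config) (T : Clock → ℕ → Ω → ℝ≥0∞) (R : ℕ → Ω → Fin 2) (ω : Ω) : Data :=
  ⟨C ω, fun c n => T c n ω, fun n => R n ω⟩

namespace IsInput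

theorem measurable_inputData {mu1 mu2 : ℝ} (hi : IsInput P lam mu1 mu2 mu12 p C T R) :
    Measurable (inputData C T R) :=
  measurable_data_iff.2 ⟨hi.measurable_init, hi.measurable_clock, hi.measurable_choice⟩

theorem hasExpLaw {mu1 mu2 : ℝ} (hi : IsInput P lam mu1 mu2 mu12 p C T R) (c : Clock) (n : ℕ) :
    HasExpLaw (rate lam mu1 mu2 mu12 c) (P.map (T c n)) := fun t ht => by
  rw [Measure.map_apply (hi.measurable_clock c n) measurableSet_Ioi]
  exact hi.survival c n t ht

theorem map_choice_eq [IsProbabilityMeasure P] {mu1 mu2 : ℝ} (hi : IsInput P lam mu1 mu2 mu12 p C T R) (n : ℕ) :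
    P.map (R n) = P.map (R 0) := by
  have h0 : ∀ n, P.map (R n) {0} = ENNReal.ofReal p := fun n => by
    rw [Measure.map_apply (hi.measurable_choice n) (measurableSet_singleton 0)]
    exact hi.choice n
  have hP : ∀ n, IsProbabilityMeasure (P.map (R n)) := fun n =>
    Measure.isProbabilityMeasure_map (hi.measurable_choice n).aemeasurable
  have h1 : ∀ n, P.map (R n) {1} = 1 - ENNReal.ofReal p := fun n => by
    rw [← h0 n, ← prob_compl_eq_one_sub (measurableSet_singleton 0)]
    congr 1
    ext b
    fin_cases b <;> simp
  refine Measure.ext_of_singleton fun b => ?_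
  fin_cases b
  · exact (h0 n).trans (h0 0).symm
  · exact (h1 n).trans (h1 0).symm

/-- The law of the input is a mixture of the laws with fresh clocks. -/
theorem measure_inputData [IsProbabilityMeasure P] {mu1 mu2 : ℝ} (hi : IsInput P lam mu1 mu2 mu12 p C T R)
    [∀ c, IsProbabilityMeasure (P.map (T c 0))] [IsProbabilityMeasure (P.map (R 0))]
    {A : Set Data} (hA : MeasurableSet A) :
    P (inputData C T R ⁻¹' A) =
      ∫⁻ c, law (fun c => P.map (T c 0)) (P.map (R 0)) c A ∂P.map C := by
  have hT : ∀ cn : Clock × ℕ, IsProbabilityMeasure (P.map (T cn.1 cn.2)) := fun cn =>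
    Measure.isProbabilityMeasure_map (hi.measurable_clock _ _).aemeasurable
  have hTm : Measurable fun ω (cn : Clock × ℕ) => T cn.1 cn.2 ω :=
    measurable_pi_lambda _ fun cn => hi.measurable_clock cn.1 cn.2
  have hRm : Measurable fun ω n => R n ω := measurable_pi_lambda _ hi.measurable_choice
  -- The survival function determines the law, so the entries of the stream of a given clock are
  -- identically distributed.
  have hclock : P.map (fun ω (cn : Clock × ℕ) => T cn.1 cn.2 ω) =
      Measure.infinitePi fun cn : Clock × ℕ => P.map (T cn.1 0) := by
    have h1 := hi.indep_clocks.map_fun_eq_infinitePi_map fun cn : Clock × ℕ =>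
      hi.measurable_clock cn.1 cn.2
    rw [h1]
    have h2 : (fun cn : Clock × ℕ => P.map (T cn.1 cn.2)) = fun cn => P.map (T cn.1 0) :=
      funext fun cn => (hi.hasExpLaw cn.1 cn.2).unique (hi.hasExpLaw cn.1 0)
    congr 1
  have hchoice : P.map (fun ω n => R n ω) = iidStream (P.map (R 0)) := by
    have h1 := hi.indep_choices.map_fun_eq_infinitePi_map hi.measurable_choice
    rw [h1, iidStream]
    have h2 : (fun n => P.map (R n)) = fun _ => P.map (R 0) := funext hi.map_choice_eq
    congr 1
  have hnoise := (indepFun_iff_map_prod_eq_prod_map_map hTm.aemeasurable hRm.aemeasurable).1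
    hi.indep_clocks_choices
  have hall := (indepFun_iff_map_prod_eq_prod_map_map hi.measurable_init.aemeasurable
    (hTm.prodMk hRm).aemeasurable).1 hi.indep_init
  -- The input is one family indexed by pairs; currying groups it into one stream per clock, and
  -- over the finitely many clocks the infinite product is a finite one.
  have hcurry : clockLaw (fun c => P.map (T c 0)) = (Measure.infinitePi
      fun cn : Clock × ℕ => P.map (T cn.1 0)).map (MeasurableEquiv.curry Clock ℕ ℝ≥0∞) := by
    rw [Measure.infinitePi_map_curry (fun c (_ : ℕ) => P.map (T c 0)), Measure.infinitePi_eq_pi]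
    rfl
  have hmk : Measurable fun z : Config × ((Clock × ℕ → ℝ≥0∞) × (ℕ → Fin 2)) =>
      Data.mk z.1 (fun c n => z.2.1 (c, n)) z.2.2 :=
    measurable_data_iff.2 ⟨measurable_fst,
      fun c k => (measurable_pi_apply (c, k)).comp (measurable_fst.comp measurable_snd),
      fun k => (measurable_pi_apply k).comp (measurable_snd.comp measurable_snd)⟩
  have hmA : MeasurableSet {z : Config × ((Clock × ℕ → ℝ≥0∞) × (ℕ → Fin 2)) |
      Data.mk z.1 (fun c n => z.2.1 (c, n)) z.2.2 ∈ A} := hmk hA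
  have h1 : P (inputData C T R ⁻¹' A) =
      (P.map fun ω => (C ω, (fun cn : Clock × ℕ => T cn.1 cn.2 ω), fun n => R n ω))
        {z | Data.mk z.1 (fun c n => z.2.1 (c, n)) z.2.2 ∈ A} := by
    rw [Measure.map_apply (hi.measurable_init.prodMk (hTm.prodMk hRm)) hmA]
    rfl
  rw [h1, hall, hnoise, hclock, hchoice, Measure.prod_apply hmA]
  refine lintegral_congr fun c => ?_
  have hmp : MeasurePreserving (MeasurableEquiv.curry Clock ℕ ℝ≥0∞)
      (Measure.infinitePi fun cn : Clock × ℕ => P.map (T cn.1 0))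
      (clockLaw fun c => P.map (T c 0)) := ⟨MeasurableEquiv.measurable _, hcurry.symm⟩
  rw [law_apply c hA]
  exact (hmp.prod (MeasurePreserving.id (iidStream (P.map (R 0))))).measure_preimage
    (measurable_mk c hA).nullMeasurableSet

theorem ae_inputData [IsProbabilityMeasure P] {mu1 mu2 : ℝ}
    (hi : IsInput P lam mu1 mu2 mu12 p C T R)
    [∀ c, IsProbabilityMeasure (P.map (T c 0))] [IsProbabilityMeasure (P.map (R 0))]
    {A : Set Data} (hA : MeasurableSet A)
    (hA' : ∀ c, ∀ᵐ d ∂law (fun c => P.map (T c 0)) (P.map (R 0)) c, d ∈ A) :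
    ∀ᵐ ω ∂P, inputData C T R ω ∈ A := by
  have h1 := hi.measure_inputData hA.compl
  have h2 : ∀ c, law (fun c => P.map (T c 0)) (P.map (R 0)) c Aᶜ = 0 := fun c => ae_iff.1 (hA' c)
  simp only [h2, lintegral_zero] at h1
  exact ae_iff.2 h1

end IsInput

end Queue

/-! ### Equal servers: transfer of both conclusions to the queue -/

section HomogeneousQueue

variable {Ω : Type*} [MeasurableSpace Ω] {P : Measure Ω} [IsProbabilityMeasure P]
  {lam mu mu12 p : ℝ} {C : Ω → Config} {T : Clock → ℕ → Ω → ℝ≥0∞} {R : ℕ → Ω → Fin 2}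

namespace IsInput

theorem isProbabilityMeasure_clock (hi : IsInput P lam mu mu mu12 p C T R) (c : Clock) :
    IsProbabilityMeasure (P.map (T c 0)) :=
  Measure.isProbabilityMeasure_map (hi.measurable_clock c 0).aemeasurable

theorem isProbabilityMeasure_choice (hi : IsInput P lam mu mu mu12 p C T R) :
    IsProbabilityMeasure (P.map (R 0)) :=
  Measure.isProbabilityMeasure_map (hi.measurable_choice 0).aemeasurable

omit [IsProbabilityMeasure P] in
theorem isHomogeneous (hi : IsInput P lam mu mu mu12 p C T R) (hlam : 0 < lam) (hmu : 0 ≤ mu)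
    (hmu12 : 0 ≤ mu12) : IsHomogeneous lam mu mu12 fun c => P.map (T c 0) :=
  ⟨hlam, hmu, hmu12, fun k => hi.hasExpLaw k 0⟩

/-- The number of customers is a Markov chain. -/
theorem isCTMC_queue (hi : IsInput P lam mu mu mu12 p C T R) (hlam : 0 < lam) (hmu : 0 ≤ mu)
    (hmu12 : 0 ≤ mu12) : IsCTMC P (queue C T R) (Q0 lam mu mu12) := by
  have := hi.isProbabilityMeasure_clock
  have := hi.isProbabilityMeasure_choice
  have h := hi.isHomogeneous hlam hmu hmu12
  set ρ : Clock → Measure ℝ≥0∞ := fun c => P.map (T c 0) with hρ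
  set χ := P.map (R 0) with hχ
  refine ⟨fun t => (measurable_numberAt t).comp hi.measurable_inputData,
    fun t i j => (transition ρ χ t i j).toReal, h.isTransitionFunction,
    h.hasDerivWithinAt_transition, fun n t i ht => ?_⟩
  -- The initial configuration enters only through the factor for the time `t 0`, which is the same
  -- for `n` and `n + 1`.
  have key : ∀ n, P {ω | ∀ k ≤ n, queue C T R (t k) ω = i k} =
      (∫⁻ c : Config, transition ρ χ (t 0) c.number (i 0) ∂P.map C) *
        ∏ k ∈ Finset.range n, transition ρ χ (t (k + 1) - t k) (i k) (i (k + 1)) := fun n => by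
    have h1 := hi.measure_inputData (measurableSet_forall_numberAt n t i)
    rw [← lintegral_mul_const' _ _ (ENNReal.prod_ne_top fun k _ => transition_ne_top _ _ _)]
    exact h1.trans (lintegral_congr fun c => h.law_forall_numberAt n t i ht c)
  rw [key (n + 1), key n, Finset.prod_range_succ, ← mul_assoc]
  congr 1
  exact (ENNReal.ofReal_toReal (transition_ne_top _ _ _)).symm

/-- The sojourn times and the embedded chain of the number of customers. -/
theorem hasSojournsAndEmbeddedChain_queue (hi : IsInput P lam mu mu mu12 p C T R) (hlam : 0 < lam)
    (hmu : 0 ≤ mu) (hmu12 : 0 ≤ mu12) :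
    HasSojournsAndEmbeddedChain P (queue C T R) (sojournRate lam mu mu12)
      (jumpProb lam mu mu12) := by
  have := hi.isProbabilityMeasure_clock
  have := hi.isProbabilityMeasure_choice
  have h := hi.isHomogeneous hlam hmu hmu12
  set ρ : Clock → Measure ℝ≥0∞ := fun c => P.map (T c 0) with hρ
  set χ := P.map (R 0) with hχ
  have hD := hi.measurable_inputData
  have hw : ∀ᵐ ω ∂P, ∀ n, 0 < ((inputData C T R ω).after n).wait ∧
      ((inputData C T R ω).after n).wait < ⊤ := by
    have hm : MeasurableSet {d : Data | 0 < d.wait ∧ d.wait < ⊤} :=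
      (measurableSet_lt_wait 0).inter (measurableSet_lt measurable_wait measurable_const)
    refine ae_all_iff.2 fun n => hi.ae_inputData (measurable_after n hm) fun c => ?_
    exact h.ae_after hm (fun c => (h.ae_wait_pos c).and (h.ae_wait_lt_top c)) n c
  refine ⟨h.sojournRate_pos, h.jumpProb_nonneg, fun i => if_pos rfl, h.hasSum_jumpProb,
    fun n ω => ((inputData C T R ω).after n).config.number,
    fun n ω => ((inputData C T R ω).after n).wait.toReal,
    fun n => measurable_number.comp ((measurable_after n).comp hD),
    fun n => (measurable_wait.comp ((measurable_after n).comp hD)).ennreal_toReal, ?_, ?_⟩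
  · have hne : ∀ᵐ ω ∂P, (inputData C T R ω).NonExplosive := by
      have hm : MeasurableSet {d : Data | d.NonExplosive} := by
        have : {d : Data | d.NonExplosive} = ⋂ N : ℕ, ⋃ n, {d | (N : ℝ≥0∞) ≤ d.time n} := by
          ext; simp [Data.NonExplosive]
        rw [this]
        exact .iInter fun N => .iUnion fun n =>
          measurableSet_le measurable_const (measurable_time n)
      exact hi.ae_inputData hm h.ae_nonExplosive
    filter_upwards [hw, hne] with ω hω hω'
    set d := inputData C T R ω with hd
    have htop : ∀ n, d.time n ≠ ⊤ := fun n => (ENNReal.sum_lt_top.2 fun k _ => (hω k).2).ne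
    have hsum : ∀ n, ∑ k ∈ Finset.range n, (d.after k).wait.toReal = (d.time n).toReal :=
      fun n => (ENNReal.toReal_sum fun k _ => (hω k).2.ne).symm
    refine ⟨fun n => ENNReal.toReal_pos (hω n).1.ne' (hω n).2.ne, fun n => ?_, ?_, ?_⟩
    · rw [Data.after_succ']
      exact Data.number_step_ne _
    · simp only [hsum]
      refine tendsto_atTop_atTop_of_monotone
        (fun a b hab => ENNReal.toReal_mono (htop b) (d.time_mono hab)) fun x => ?_
      obtain ⟨N, hN⟩ := exists_nat_ge x
      obtain ⟨n, hn⟩ := hω' N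
      refine ⟨n, hN.trans ?_⟩
      simpa using ENNReal.toReal_mono (htop n) hn
    · intro n t h1 h2
      rw [hsum] at h1 h2
      refine Data.numberAt_eq ?_ ?_
      · rw [← ENNReal.ofReal_coe_nnreal]
        exact (ENNReal.le_ofReal_iff_toReal_le (htop n) t.coe_nonneg).2 h1
      · rw [← ENNReal.ofReal_coe_nnreal]
        exact (ENNReal.ofReal_lt_iff_lt_toReal t.coe_nonneg (htop (n + 1))).2 h2
  · intro n i u
    have h0 : P {ω | queue C T R 0 ω = i 0} =
        ∫⁻ c : Config, (if c.number = i 0 then 1 else 0) ∂P.map C := by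
      have h1 := hi.measure_inputData (measurableSet_numberAt 0 (i 0))
      refine h1.trans (lintegral_congr fun c => ?_)
      rw [h.law_numberAt, h.transition_zero]
    have hprod : ∏ k ∈ Finset.range n, ENNReal.ofReal (jumpProb lam mu mu12 (i k) (i (k + 1)) *
        Real.exp (-(sojournRate lam mu mu12 (i k) * u k))) ≠ ⊤ :=
      ENNReal.prod_ne_top fun k _ => ENNReal.ofReal_ne_top
    have h1 := hi.measure_inputData (measurableSet_jumpPath n i u)
    rw [h0, ← lintegral_mul_const' _ _ hprod]
    refine Eq.trans (measure_congr ?_) (h1.trans (lintegral_congr fun c => ?_))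
    · filter_upwards [hw] with ω hω
      refine propext (and_congr_right fun _ => forall₂_congr fun k _ => ?_)
      rw [← ENNReal.ofReal_coe_nnreal]
      exact (ENNReal.ofReal_lt_iff_lt_toReal (u k).coe_nonneg (hω k).2.ne).symm
    · rw [h.law_jumpPath, ite_mul, one_mul, zero_mul]

end IsInput

end HomogeneousQueue

end MMD2

theorem corollary1 {Ω : Type*} [MeasurableSpace Ω] (P : Measure Ω) [IsProbabilityMeasure P]
    (lam mu mu12 p : ℝ) (hlam : 0 < lam) (hmu : 0 ≤ mu) (hmu12 : 0 ≤ mu12)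
    (hp0 : 0 ≤ p) (hp1 : p ≤ 1)
    (C : Ω → MMD2.Config) (T : MMD2.Clock → ℕ → Ω → ℝ≥0∞) (R : ℕ → Ω → Fin 2)
    (hinput : MMD2.IsInput P lam mu mu mu12 p C T R) :
    IsCTMC P (MMD2.queue C T R) (MMD2.Q0 lam mu mu12) ∧
      ∃ (θ : ℕ → ℝ) (r : ℕ → ℕ → ℝ),
        (∀ i, MMD2.Q0 lam mu mu12 i i = -θ i) ∧
        (∀ i j, i ≠ j → MMD2.Q0 lam mu mu12 i j = θ i * r i j) ∧
        HasSojournsAndEmbeddedChain P (MMD2.queue C T R) θ r :=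
  ⟨hinput.isCTMC_queue hlam hmu hmu12, MMD2.sojournRate lam mu mu12, MMD2.jumpProb lam mu mu12,
    MMD2.Q0_diag, fun _ _ hij => (hinput.isHomogeneous hlam hmu hmu12).Q0_off_diag hij,
    hinput.hasSojournsAndEmbeddedChain_queue hlam hmu hmu12⟩
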